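/- Let $X_1, X_2, \ldots$ be independent real random variables with common distribution function $F$, where $F$ has a bounded probability density function $f$ and finite variance. Let $VJ(X)=\operatorname{Var}\left[-\tfrac12 f(X)\right]$, where $X$ has distribution function $F$, be the varextropy. For $n\ge 1$ let $X_{(1)}\le\cdots\le X_{(n)}$ be the order statistics of $X_1,\ldots,X_n$, and put $X_{(i)}=X_{(1)}$ for $i<1$ and $X_{(i)}=X_{(n)}$ for $i>n$. For a positive integer $m<n/2$ let $$c_i=\begin{cases}1+\frac{i-1}{m}, & 1\le i\le m,\\ 2, & m+1\le i\le n-m,\\ 1+\frac{n-i}{m}, & n-m+1\le i\le n,\end{cases}$$ and $$VJQ_{m,n}=\frac14\left[\frac1n\sum_{i=1}^n\left(\frac{c_i\,m/n}{X_{(i+m)}-X_{(i-m)}}\right)^2-\left(\frac1n\sum_{i=1}^n\frac{c_i\,m/n}{X_{(i+m)}-X_{(i-m)}}\right)^2\right].$$ If $m=m_n$ is a sequence of positive integers with $m_n\to\infty$ and $m_n/n\to0$ as $n\to\infty$, then $VJQ_{m_n,n}\to VJ(X)$ in probability. -/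

import Mathlib

open MeasureTheory ProbabilityTheory Filter Topology

noncomputable section

/-- The law on the real line with Lebesgue density `f`. -/
def densityLaw (f : ℝ → ℝ) : Measure ℝ :=
  volume.withDensity (fun x => ENNReal.ofReal (f x))

/-- The varextropy `VJ(X) = Var[-f(X)/2]` of a random variable `X` with density `f`, computed
under the law of `X`. -/
def varextropy (f : ℝ → ℝ) : ℝ :=
  variance (fun x => -(1 / 2 : ℝ) * f x) (densityLaw f)

/-- The order statistic `X_(i)` of the sample `x` of size `n`, for an arbitrary integer `i`:
`X_(1) ≤ ... ≤ X_(n)` is the sorted sample, `X_(i) = X_(1)` if `i < 1` and `X_(i) = X_(n)` if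
`i > n`. (For the empty sample the value is `0`.) -/
def orderStat {n : ℕ} (x : Fin n → ℝ) (i : ℤ) : ℝ :=
  if h : 0 < n then
    x (Tuple.sort x ⟨(max 1 (min i (n : ℤ)) - 1).toNat, by omega⟩)
  else 0

/-- The weights `c_i`, `1 ≤ i ≤ n`, for the window size `m`. -/
def spacingWeight (m n i : ℕ) : ℝ :=
  if i ≤ m then 1 + ((i : ℝ) - 1) / m
  else if i + m ≤ n then 2
  else 1 + ((n : ℝ) - i) / m

/-- The local density estimate `(c_i m / n) / (X_(i+m) - X_(i-m))`. -/
def spacingRatio (m : ℕ) {n : ℕ} (x : Fin n → ℝ) (i : ℕ) : ℝ :=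
  (spacingWeight m n i * ((m : ℝ) / n)) /
    (orderStat x ((i : ℤ) + m) - orderStat x ((i : ℤ) - m))

/-- The estimator `VJQ_{m,n}` evaluated at the sample `x` of size `n`. -/
def VJQ (m : ℕ) {n : ℕ} (x : Fin n → ℝ) : ℝ :=
  (1 / 4 : ℝ) *
    ((1 / (n : ℝ)) * ∑ i ∈ Finset.Icc 1 n, spacingRatio m x i ^ 2
      - ((1 / (n : ℝ)) * ∑ i ∈ Finset.Icc 1 n, spacingRatio m x i) ^ 2)

end

/-! ### Order statistics -/

/-! Write μ for the common law. Multiplying and dividing by the μ-mass of the window factors each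
local estimate as Y_i · G_i (`spacingRatio_eq`): Y_i is `normSpacing`, built from the mass of the
window, and G_i is the average of f over the window. If Y_i is near 1 in mean square and G_i is near
f(X_(i)) in mean absolute value, the two empirical moments in `VJQ` have the same limits as the
sample means of f² and f, and the law of large numbers concludes (`tendsto_VJQ`).

For Y, use (y - 1)² ≤ y² + 2/y - 3. The mean of 1/Y_i in the interior is controlled
deterministically, because window masses telescope. The mean of Y_i² has expectation at most
(2m)²/((2m-1)(2m-2)), which tends to 1, so the bound tends to 1 + 2 - 3 = 0. The 2m edge terms are
negligible through a third-moment truncation; there the weights matter only through 1 ≤ c_i ≤ 2.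

The inverse moments come from counting instead of Beta integrals. The expected sum of p^(-q), over
ordered pairs whose gap has mass p and contains exactly j points, is a binomial integral; the
absorption identity removes one inverse power at a time (`pairInt_succ_le`), and for q = 0 one only
counts pairs (`pairInt_zero_le`).

For G, approximate f in L¹ by continuous compactly supported g. The oscillation of g on windows and
the window averages of |f - g| both reduce to telescoping sums, except on windows where Y_i > 2,
which the mean square deviation pays for (`windowError_le`).

The deviation of Y tends to 0 only in probability, so the final argument runs pathwise along almost
surely convergent subsequences. -/

theorem orderStat_monotone {n : ℕ} (x : Fin n → ℝ) : Monotone (orderStat x) := by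
  intro i j hij
  unfold orderStat
  split_ifs with h
  · apply Tuple.monotone_sort x
    rw [Fin.mk_le_mk]
    omega
  · exact le_rfl

theorem orderStat_natCast {n : ℕ} (x : Fin n → ℝ) {i : ℕ} (h₁ : 1 ≤ i) (hn : i ≤ n) :
    orderStat x (i : ℤ) = x (Tuple.sort x ⟨i - 1, by omega⟩) := by
  unfold orderStat
  rw [dif_pos (by omega)]
  congr 3
  omega

theorem sum_orderStat {n : ℕ} {M : Type*} [AddCommMonoid M] (x : Fin n → ℝ) (φ : ℝ → M) :
    ∑ i ∈ Finset.Icc 1 n, φ (orderStat x (i : ℤ)) = ∑ j, φ (x j) := by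
  rw [← Equiv.sum_comp (Tuple.sort x) (fun j => φ (x j))]
  refine Finset.sum_bij' (fun i hi => ⟨i - 1, by rw [Finset.mem_Icc] at hi; omega⟩)
    (fun j _ => j.1 + 1) (by simp) (by intro j _; simp) ?_ (by simp) ?_
  · intro i hi
    rw [Finset.mem_Icc] at hi
    dsimp only
    omega
  · intro i hi
    rw [Finset.mem_Icc] at hi
    rw [orderStat_natCast x hi.1 hi.2]

theorem sort_strictMono {n : ℕ} {x : Fin n → ℝ} (hx : Function.Injective x) :
    StrictMono (x ∘ Tuple.sort x) :=
  (Tuple.monotone_sort x).strictMono_of_injective (hx.comp (Tuple.sort x).injective)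

theorem orderStat_lt {n : ℕ} {x : Fin n → ℝ} (hx : Function.Injective x) (hn : 2 ≤ n)
    {i j : ℤ} (hij : i < j) (hi : i < n) (hj : 1 < j) : orderStat x i < orderStat x j := by
  unfold orderStat
  split_ifs with h
  · apply sort_strictMono hx
    rw [Fin.mk_lt_mk]
    omega
  · omega

/-- The number of sample points strictly between two sample points. -/
noncomputable def betweenCard {ι : Type*} [Fintype ι] (x : ι → ℝ) (a b : ι) : ℕ :=
  (Finset.univ.filter fun c => x c ∈ Set.Ioo (x a) (x b)).card

theorem betweenCard_sort {n : ℕ} {x : Fin n → ℝ} (hx : Function.Injective x) (p q : Fin n) :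
    betweenCard x (Tuple.sort x p) (Tuple.sort x q) = q.1 - p.1 - 1 := by
  unfold betweenCard
  have : (Finset.univ.filter fun c => x c ∈ Set.Ioo (x (Tuple.sort x p)) (x (Tuple.sort x q)))
      = (Finset.Ioo p q).map (Tuple.sort x).toEmbedding := by
    ext c
    obtain ⟨d, rfl⟩ := (Tuple.sort x).surjective c
    have h := (sort_strictMono hx)
    simp only [Finset.mem_filter, Finset.mem_univ, true_and, Set.mem_Ioo, Finset.mem_map,
      Finset.mem_Ioo, Equiv.coe_toEmbedding, EmbeddingLike.apply_eq_iff_eq, exists_eq_right]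
    exact and_congr (h.lt_iff_lt (a := p) (b := d)) (h.lt_iff_lt (a := d) (b := q))
  rw [this, Finset.card_map, Fin.card_Ioo]

/-- Order statistics j + 1 ranks apart are labelled pairs with j points between. Passing to labels
makes the expectation computable: each summand involves two fixed variables and an independent
remainder. -/
theorem sum_orderStat_gap_le {n : ℕ} {x : Fin n → ℝ} (hx : Function.Injective x) (j : ℕ)
    (g : ℝ → ℝ → ENNReal) :
    ∑ l ∈ Finset.Icc 1 (n - (j + 1)), g (orderStat x (l : ℤ)) (orderStat x ((l + (j + 1) : ℕ) : ℤ))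
      ≤ ∑ a, ∑ b, if x a < x b ∧ betweenCard x a b = j then g (x a) (x b) else 0 := by
  classical
  rw [← Finset.sum_product']
  have hmap : ∀ l ∈ Finset.Icc 1 (n - (j + 1)), 1 ≤ l ∧ l + (j + 1) ≤ n := by
    intro l hl
    rw [Finset.mem_Icc] at hl
    omega
  rw [← Finset.sum_attach]
  let e : {l // l ∈ Finset.Icc 1 (n - (j + 1))} → Fin n × Fin n := fun l =>
    (Tuple.sort x ⟨l.1 - 1, by have := hmap _ l.2; omega⟩,
      Tuple.sort x ⟨l.1 + (j + 1) - 1, by have := hmap _ l.2; omega⟩)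
  have he : Function.Injective e := by
    intro l l' h
    have h1 := congrArg Prod.fst h
    simp only [e, EmbeddingLike.apply_eq_iff_eq, Fin.mk.injEq] at h1
    have := hmap _ l.2
    have := hmap _ l'.2
    exact Subtype.ext (by omega)
  calc _ = ∑ l ∈ (Finset.Icc 1 (n - (j + 1))).attach,
        (fun p : Fin n × Fin n => if x p.1 < x p.2 ∧ betweenCard x p.1 p.2 = j then
          g (x p.1) (x p.2) else 0) (e l) := by
        refine Finset.sum_congr rfl fun l _ => ?_
        obtain ⟨h1, h2⟩ := hmap _ l.2
        rw [orderStat_natCast x h1 (by omega), orderStat_natCast x (by omega) h2]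
        dsimp only [e]
        rw [if_pos]
        refine ⟨sort_strictMono hx ?_, ?_⟩
        · rw [Fin.mk_lt_mk]; omega
        · rw [betweenCard_sort hx]
          simp only
          omega
    _ = ∑ p ∈ (Finset.Icc 1 (n - (j + 1))).attach.image e,
        (if x p.1 < x p.2 ∧ betweenCard x p.1 p.2 = j then g (x p.1) (x p.2) else 0) := by
        rw [Finset.sum_image he.injOn]
    _ ≤ _ := Finset.sum_le_sum_of_subset (by intro p _; simp)

theorem betweenCard_lt {ι : Type*} [Fintype ι] {x : ι → ℝ} {a b b' : ι} (hab : x a < x b)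
    (hbb : x b < x b') : betweenCard x a b < betweenCard x a b' := by
  apply Finset.card_lt_card
  rw [Finset.ssubset_iff_of_subset]
  · exact ⟨b, by simp [hab, hbb], by simp⟩
  · intro c
    simp only [Finset.mem_filter, Finset.mem_univ, true_and, Set.mem_Ioo]
    exact fun h => ⟨h.1, h.2.trans hbb⟩

/-- The count of points between grows strictly with the right endpoint, so each left endpoint has at
most one partner. -/
theorem sum_gap_one_le {ι : Type*} [Fintype ι] {x : ι → ℝ} (hx : Function.Injective x) (j : ℕ) :
    ∑ a, ∑ b, (if x a < x b ∧ betweenCard x a b = j then (1 : ENNReal) else 0)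
      ≤ Fintype.card ι := by
  classical
  have : ∀ a, ∑ b, (if x a < x b ∧ betweenCard x a b = j then (1 : ENNReal) else 0) ≤ 1 := by
    intro a
    rw [← Finset.sum_filter, Finset.sum_const, nsmul_eq_mul, mul_one]
    norm_cast
    rw [Finset.card_le_one]
    intro b hb b' hb'
    simp only [Finset.mem_filter, Finset.mem_univ, true_and] at hb hb'
    rcases lt_trichotomy (x b) (x b') with h | h | h
    · have := betweenCard_lt hb.1 h
      omega
    · exact hx h
    · have := betweenCard_lt hb'.1 h
      omega
  calc _ ≤ ∑ _a : ι, (1 : ENNReal) := Finset.sum_le_sum fun a _ => this a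
    _ = _ := by simp

theorem sum_Icc_sub (b : ℤ → ℝ) (n : ℕ) :
    ∑ i ∈ Finset.Icc 1 n, (b ((i : ℤ) + 1) - b i) = b ((n : ℤ) + 1) - b 1 := by
  induction n with
  | zero => simp
  | succ n ih =>
    rw [Finset.sum_Icc_succ_top (by omega), ih]
    push_cast
    ring

/-- A telescoping bound: each unit step of a monotone sequence is covered by at most `2 m` of the
windows `[i - m, i + m]`. -/
theorem sum_window_le {a : ℤ → ℝ} (c C : ℝ) (hc : ∀ i, c ≤ a i) (hC : ∀ i, a i ≤ C) (m n : ℕ) :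
    ∑ i ∈ Finset.Icc 1 n, (a ((i : ℤ) + m) - a ((i : ℤ) - m)) ≤ 2 * m * (C - c) := by
  -- Induction on the window width: widening every window by one step adds a sum that telescopes in
  -- i, hence at most C - c.
  have key : ∀ k : ℕ, ∑ i ∈ Finset.Icc 1 n, (a ((i : ℤ) - m + k) - a ((i : ℤ) - m))
      ≤ k * (C - c) := by
    intro k
    induction k with
    | zero => simp
    | succ k ih =>
      have h2 : ∑ i ∈ Finset.Icc 1 n, (a ((i : ℤ) - m + (k + 1 : ℕ)) - a ((i : ℤ) - m + k))
          ≤ C - c := by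
        have h3 := sum_Icc_sub (fun i : ℤ => a (i - m + k)) n
        have h4 : ∀ i : ℤ, i - m + (k + 1 : ℕ) = i + 1 - m + k := fun i => by push_cast; ring
        simp only [h4]
        rw [h3]
        linarith [hc (1 - m + k), hC ((n : ℤ) + 1 - m + k)]
      calc _ = ∑ i ∈ Finset.Icc 1 n, (a ((i : ℤ) - m + (k + 1 : ℕ)) - a ((i : ℤ) - m + k))
            + ∑ i ∈ Finset.Icc 1 n, (a ((i : ℤ) - m + k) - a ((i : ℤ) - m)) := by
            rw [← Finset.sum_add_distrib]
            exact Finset.sum_congr rfl fun i _ => by ring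
        _ ≤ _ := by rw [Nat.cast_succ (R := ℝ)]; linarith
  have := key (2 * m)
  push_cast at this
  convert this using 4
  ring_nf

/-- The sorting permutation takes finitely many values, and each fibre is cut out by comparisons of
coordinates, including the tie-breaking rule. -/
theorem measurable_orderStat (n : ℕ) (i : ℤ) : Measurable fun x : Fin n → ℝ => orderStat x i := by
  unfold orderStat
  split_ifs with h
  · let _ : MeasurableSpace (Equiv.Perm (Fin n)) := ⊤
    have hsort : Measurable fun x : Fin n → ℝ => Tuple.sort x := by
      refine measurable_to_countable' fun σ => ?_
      have : (fun x : Fin n → ℝ => Tuple.sort x) ⁻¹' {σ} =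
          ⋂ p : Fin n, ⋂ q : Fin n, {x | (p ≤ q → x (σ p) ≤ x (σ q)) ∧
            (p < q → x (σ p) = x (σ q) → σ p < σ q)} := by
        ext x
        simp only [Set.mem_preimage, Set.mem_singleton_iff, Set.mem_iInter, Set.mem_ofPred_eq]
        rw [eq_comm, Tuple.eq_sort_iff]
        exact ⟨fun H p q => ⟨fun hpq => H.1 hpq, H.2 p q⟩,
          fun H => ⟨fun p q hpq => (H p q).1 hpq, fun p q => (H p q).2⟩⟩
      rw [this]
      refine MeasurableSet.iInter fun p => MeasurableSet.iInter fun q => ?_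
      have hm : ∀ r, Measurable fun x : Fin n → ℝ => x r := fun r => measurable_pi_apply r
      refine MeasurableSet.inter (s₁ := {x : Fin n → ℝ | p ≤ q → x (σ p) ≤ x (σ q)})
        (s₂ := {x : Fin n → ℝ | p < q → x (σ p) = x (σ q) → σ p < σ q}) ?_ ?_
      · by_cases hpq : p ≤ q
        · simp only [hpq, forall_const]
          exact measurableSet_le (hm _) (hm _)
        · simp only [hpq, false_imp_iff]
          exact MeasurableSet.const _
      · by_cases hpq : p < q
        · by_cases hs : σ p < σ q
          · simp only [hs, implies_true]
            exact MeasurableSet.const _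
          · simp only [hpq, hs, forall_const, imp_false]
            exact (measurableSet_eq_fun (hm (σ p)) (hm (σ q))).compl
        · simp only [hpq, false_imp_iff]
          exact MeasurableSet.const _
    have hev : Measurable fun p : Equiv.Perm (Fin n) × (Fin n → ℝ) =>
        p.2 (p.1 ⟨(max 1 (min i (n : ℤ)) - 1).toNat, by omega⟩) :=
      measurable_from_prod_countable_right fun σ =>
        measurable_pi_apply (σ ⟨(max 1 (min i (n : ℤ)) - 1).toNat, by omega⟩)
    exact hev.comp (hsort.prodMk measurable_id)
  · exact measurable_const

/-! ### Moments of inverse spacings -/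

/-- The probability that a binomial variable with parameters `N`, `p` equals `j`. -/
noncomputable def binPmf (N j : ℕ) (p : ℝ) : ℝ := N.choose j * p ^ j * (1 - p) ^ (N - j)

/-- The mass of the open interval between two points. -/
noncomputable def gapMass (μ : Measure ℝ) (z : ℝ × ℝ) : ℝ := μ.real (Set.Ioo z.1 z.2)

theorem gapMass_nonneg (μ : Measure ℝ) (z : ℝ × ℝ) : 0 ≤ gapMass μ z := measureReal_nonneg

theorem gapMass_le_one (μ : Measure ℝ) [IsProbabilityMeasure μ] (z : ℝ × ℝ) : gapMass μ z ≤ 1 :=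
  measureReal_le_one

theorem measurable_gapMass (μ : Measure ℝ) [IsProbabilityMeasure μ] : Measurable (gapMass μ) := by
  have hs : MeasurableSet {p : (ℝ × ℝ) × ℝ | p.1.1 < p.2 ∧ p.2 < p.1.2} :=
    (measurableSet_lt measurable_fst.fst measurable_snd).inter
      (measurableSet_lt measurable_snd measurable_fst.snd)
  exact (measurable_measure_prodMk_left (ν := μ) hs).ennreal_toReal

theorem measurable_binPmf (N j : ℕ) : Measurable (binPmf N j) := by
  unfold binPmf
  fun_prop

/-- For p > 0 this is an equality, by the absorption identity for binomial coefficients. At p = 0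
the left side vanishes. -/
theorem binPmf_succ_mul_inv_le (N j q : ℕ) {p : ℝ} (h0 : 0 ≤ p) (h1 : p ≤ 1) :
    binPmf (N + 1) (j + 1) p * p⁻¹ ^ (q + 1)
      ≤ ((N + 1 : ℝ) / (j + 1)) * (binPmf N j p * p⁻¹ ^ q) := by
  have h1' : 0 ≤ 1 - p := by linarith
  rcases h0.eq_or_lt with rfl | hp
  · simp only [binPmf]
    rw [pow_succ (0 : ℝ) j]
    simp only [mul_zero, zero_mul]
    positivity
  · apply le_of_eq
    have h : ((N + 1).choose (j + 1) : ℝ) * (j + 1) = (N + 1) * N.choose j := by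
      exact_mod_cast (Nat.add_one_mul_choose_eq N j).symm
    have h2 : ((N + 1).choose (j + 1) : ℝ) = (N + 1) / (j + 1) * N.choose j := by
      field_simp
      linarith
    unfold binPmf
    rw [h2, Nat.add_sub_add_right, pow_succ p j, pow_succ p⁻¹ q]
    field_simp

section iid

variable {Ω ι : Type*} [MeasurableSpace Ω] {P : Measure Ω}
  {μ : Measure ℝ} {Y : ι → Ω → ℝ}

theorem measure_card_eq [IsProbabilityMeasure μ] (hm : ∀ i, Measurable (Y i)) (hi : iIndepFun Y P)
    (hl : ∀ i, P.map (Y i) = μ) {I : Set ℝ} (hI : MeasurableSet I) (T : Finset ι) (j : ℕ) :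
    P {ω | ∑ c ∈ T, I.indicator (fun _ => 1) (Y c ω) = j}
      = ENNReal.ofReal (binPmf T.card j (μ.real I)) := by
  classical
  set p := μ.real I with hp
  have hp0 : 0 ≤ p := measureReal_nonneg
  have hp1 : 0 ≤ 1 - p := by linarith [measureReal_le_one (μ := μ) (s := I)]
  have hset : {ω | ∑ c ∈ T, I.indicator (fun _ => 1) (Y c ω) = j}
      = ⋃ S ∈ Finset.powersetCard j T, ⋂ c ∈ T, Y c ⁻¹' (if c ∈ S then I else Iᶜ) := by
    ext ω
    have hsum : ∑ c ∈ T, I.indicator (fun _ => 1) (Y c ω)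
        = (T.filter fun c => Y c ω ∈ I).card := by
      rw [Finset.card_filter]
      rfl
    simp only [Set.mem_ofPred_eq, hsum, Set.mem_iUnion, Set.mem_iInter, Set.mem_preimage,
      Finset.mem_powersetCard, exists_prop]
    constructor
    · intro h
      refine ⟨_, ⟨Finset.filter_subset _ _, h⟩, fun c hc => ?_⟩
      by_cases hcI : Y c ω ∈ I <;> simp [hc, hcI]
    · rintro ⟨S, ⟨hST, hS⟩, h⟩
      rw [← hS]
      congr 1
      ext c
      rw [Finset.mem_filter]
      constructor
      · rintro ⟨hc, hcI⟩
        by_contra hcS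
        have := h c hc
        rw [if_neg hcS] at this
        exact this hcI
      · intro hc
        have := h c (hST hc)
        rw [if_pos hc] at this
        exact ⟨hST hc, this⟩
  have hmeas : ∀ (S : Finset ι) (c : ι), MeasurableSet (if c ∈ S then I else Iᶜ) := by
    intro S c
    split_ifs
    exacts [hI, hI.compl]
  rw [hset, measure_biUnion_finset]
  · have hterm : ∀ S ∈ Finset.powersetCard j T,
        P (⋂ c ∈ T, Y c ⁻¹' (if c ∈ S then I else Iᶜ))
          = ENNReal.ofReal (p ^ j * (1 - p) ^ (T.card - j)) := by
      intro S hS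
      rw [Finset.mem_powersetCard] at hS
      rw [hi.measure_inter_preimage_eq_mul T (fun c _ => hmeas S c)]
      have : ∀ c ∈ T, P (Y c ⁻¹' (if c ∈ S then I else Iᶜ))
          = ENNReal.ofReal (if c ∈ S then p else 1 - p) := by
        intro c _
        rw [← Measure.map_apply (hm c) (hmeas S c), hl c]
        split_ifs
        · rw [hp, ofReal_measureReal]
        · rw [← probReal_compl_eq_one_sub hI, ofReal_measureReal]
      rw [Finset.prod_congr rfl this, ← ENNReal.ofReal_prod_of_nonneg]
      · congr 1
        rw [Finset.prod_ite, Finset.prod_const, Finset.prod_const, Finset.filter_mem_eq_inter,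
          Finset.inter_eq_right.2 hS.1, Finset.filter_notMem_eq_sdiff,
          Finset.card_sdiff_of_subset hS.1, hS.2]
      · intro c _
        split_ifs <;> assumption
    rw [Finset.sum_congr rfl hterm, Finset.sum_const, Finset.card_powersetCard, nsmul_eq_mul]
    unfold binPmf
    rw [mul_assoc, ENNReal.ofReal_mul (Nat.cast_nonneg _), ENNReal.ofReal_natCast]
  · intro S hS S' hS' hne
    rw [Function.onFun, Set.disjoint_left]
    intro ω h h'
    simp only [Set.mem_iInter, Set.mem_preimage] at h h'
    apply hne
    simp only [Finset.mem_coe, Finset.mem_powersetCard] at hS hS'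
    ext c
    by_cases hc : c ∈ T
    · have h1 := h c hc
      have h2 := h' c hc
      by_cases hcS : c ∈ S <;> by_cases hcS' : c ∈ S' <;> simp_all
    · exact ⟨fun h => (hc (hS.1 h)).elim, fun h => (hc (hS'.1 h)).elim⟩
  · exact fun S _ => MeasurableSet.biInter T.countable_toSet fun c _ => hm c (hmeas S c)

theorem map_pair_eq [IsProbabilityMeasure P] (hm : ∀ i, Measurable (Y i)) (hi : iIndepFun Y P)
    (hl : ∀ i, P.map (Y i) = μ) {a b : ι} (hab : a ≠ b) :
    P.map (fun ω => (Y a ω, Y b ω)) = μ.prod μ := by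
  rw [(indepFun_iff_map_prod_eq_prod_map_map (hm a).aemeasurable (hm b).aemeasurable).1
    (hi.indepFun hab), hl, hl]

/-- Condition on the two endpoints: they are independent of the points indexed by T, so by Fubini
the inner count is binomial with success probability the mass of the gap. -/
theorem lintegral_between_card [IsProbabilityMeasure P] [IsProbabilityMeasure μ]
    (hm : ∀ i, Measurable (Y i)) (hi : iIndepFun Y P)
    (hl : ∀ i, P.map (Y i) = μ) {a b : ι} (hab : a ≠ b) {T : Finset ι} (ha : a ∉ T) (hb : b ∉ T)
    (j : ℕ) {g : ℝ × ℝ → ENNReal} (hg : Measurable g) :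
    ∫⁻ ω, (if ∑ c ∈ T, (Set.Ioo (Y a ω) (Y b ω)).indicator (fun _ => 1) (Y c ω) = j
        then g (Y a ω, Y b ω) else 0) ∂P
      = ∫⁻ z, ENNReal.ofReal (binPmf T.card j (gapMass μ z)) * g z ∂(μ.prod μ) := by
  classical
  set W : Ω → ℝ × ℝ := fun ω => (Y a ω, Y b ω) with hW
  set V : Ω → T → ℝ := fun ω i => Y i ω with hV
  have hWm : Measurable W := (hm a).prodMk (hm b)
  have hVm : Measurable V := measurable_pi_lambda _ fun i => hm i
  have hind : IndepFun W V P := by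
    have h := hi.indepFun_finset {a, b} T (by simp [ha, hb]) hm
    have hφ : Measurable fun v : ({a, b} : Finset ι) → ℝ =>
        (v ⟨a, by simp⟩, v ⟨b, by simp⟩) :=
      (measurable_pi_apply _).prodMk (measurable_pi_apply _)
    exact h.comp hφ measurable_id
  have hlaw : P.map (fun ω => (W ω, V ω)) = (μ.prod μ).prod (P.map V) := by
    rw [(indepFun_iff_map_prod_eq_prod_map_map hWm.aemeasurable hVm.aemeasurable).1 hind,
      map_pair_eq hm hi hl hab]
  let N : (ℝ × ℝ) × (T → ℝ) → ℕ := fun p =>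
    ∑ c : T, (Set.Ioo p.1.1 p.1.2).indicator (fun _ => 1) (p.2 c)
  have hN : Measurable N := by
    refine Finset.measurable_sum _ fun c _ => ?_
    have hc : Measurable fun p : (ℝ × ℝ) × (T → ℝ) => p.2 c :=
      (measurable_pi_apply c).comp measurable_snd
    have hs : MeasurableSet {p : (ℝ × ℝ) × (T → ℝ) | p.1.1 < p.2 c ∧ p.2 c < p.1.2} :=
      (measurableSet_lt measurable_fst.fst hc).inter (measurableSet_lt hc measurable_fst.snd)
    exact Measurable.ite hs measurable_const measurable_const
  have hS : MeasurableSet {p | N p = j} := hN (measurableSet_singleton j)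
  let F : (ℝ × ℝ) × (T → ℝ) → ENNReal := fun p => {p | N p = j}.indicator (fun p => g p.1) p
  have hF : Measurable F := (hg.comp measurable_fst).indicator hS
  have hsum : ∀ ω x y, ∑ c ∈ T, (Set.Ioo x y).indicator (fun _ => 1) (Y c ω)
      = N ((x, y), V ω) := fun ω x y =>
    (Finset.sum_coe_sort T fun c => (Set.Ioo x y).indicator (fun _ => 1) (Y c ω)).symm
  calc _ = ∫⁻ ω, F (W ω, V ω) ∂P := by
        refine lintegral_congr fun ω => ?_
        rw [hsum]
        by_cases h : N ((Y a ω, Y b ω), V ω) = j <;> simp [F, hW, h]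
    _ = ∫⁻ p, F p ∂(P.map fun ω => (W ω, V ω)) := (lintegral_map hF (hWm.prodMk hVm)).symm
    _ = ∫⁻ z, ∫⁻ v, F (z, v) ∂(P.map V) ∂(μ.prod μ) := by
        have : IsProbabilityMeasure (P.map V) := Measure.isProbabilityMeasure_map hVm.aemeasurable
        rw [hlaw, lintegral_prod _ hF.aemeasurable]
    _ = _ := by
        refine lintegral_congr fun z => ?_
        have h1 : ∀ v, F (z, v) = {v | N (z, v) = j}.indicator (fun _ => g z) v := fun v => rfl
        have hSz : MeasurableSet {v | N (z, v) = j} := measurable_prodMk_left hS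
        simp only [h1]
        rw [lintegral_indicator_const hSz, Measure.map_apply hVm hSz, mul_comm]
        congr 1
        rw [gapMass, ← measure_card_eq hm hi hl measurableSet_Ioo T j]
        congr 1
        ext ω
        simp only [Set.mem_preimage, Set.mem_ofPred_eq, hsum]


theorem ae_ne_of_ne [IsProbabilityMeasure P] [IsProbabilityMeasure μ] [NullSingletonClass μ]
    (hm : ∀ i, Measurable (Y i)) (hi : iIndepFun Y P) (hl : ∀ i, P.map (Y i) = μ) {a b : ι}
    (hab : a ≠ b) : ∀ᵐ ω ∂P, Y a ω ≠ Y b ω := by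
  have hs : MeasurableSet {z : ℝ × ℝ | z.1 = z.2} :=
    measurableSet_eq_fun measurable_fst measurable_snd
  have h0 : (μ.prod μ) {z : ℝ × ℝ | z.1 = z.2} = 0 := by
    rw [Measure.prod_apply hs]
    simp only [lintegral_eq_zero_iff (measurable_measure_prodMk_left hs)]
    refine Filter.Eventually.of_forall fun x => ?_
    have : Prod.mk x ⁻¹' {z : ℝ × ℝ | z.1 = z.2} = {x} := by
      ext y
      simp [eq_comm]
    simp [this]
  rw [← map_pair_eq hm hi hl hab, Measure.map_apply ((hm a).prodMk (hm b)) hs] at h0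
  exact measure_eq_zero_iff_ae_notMem.1 h0

theorem ae_injective [Countable ι] [IsProbabilityMeasure P] [IsProbabilityMeasure μ] [NullSingletonClass μ]
    (hm : ∀ i, Measurable (Y i)) (hi : iIndepFun Y P) (hl : ∀ i, P.map (Y i) = μ) :
    ∀ᵐ ω ∂P, Function.Injective fun i => Y i ω := by
  have : ∀ᵐ ω ∂P, ∀ a b, a ≠ b → Y a ω ≠ Y b ω := by
    rw [ae_all_iff]
    intro a
    rw [ae_all_iff]
    intro b
    by_cases hab : a = b
    · simp [hab]
    · filter_upwards [ae_ne_of_ne hm hi hl hab] with ω h _ using h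
  filter_upwards [this] with ω h a b hab
  by_contra hne
  exact h a b hne hab

/-- A third independent point almost never falls in a gap of mass zero: the binomial weight of one
success in one trial vanishes at p = 0. -/
theorem ae_gapMass_pos [Countable ι] [IsProbabilityMeasure P] [IsProbabilityMeasure μ]
    (hm : ∀ i, Measurable (Y i)) (hi : iIndepFun Y P) (hl : ∀ i, P.map (Y i) = μ) :
    ∀ᵐ ω ∂P, ∀ a b c, Y a ω < Y c ω → Y c ω < Y b ω → 0 < gapMass μ (Y a ω, Y b ω) := by
  rw [ae_all_iff]
  intro a
  rw [ae_all_iff]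
  intro b
  rw [ae_all_iff]
  intro c
  by_cases hab : a = b
  · exact Filter.Eventually.of_forall fun ω h1 h2 => absurd (h1.trans h2) (by simp [hab])
  by_cases hac : a = c
  · exact Filter.Eventually.of_forall fun ω h1 => absurd h1 (by simp [hac])
  by_cases hbc : b = c
  · exact Filter.Eventually.of_forall fun ω h1 h2 => absurd h2 (by simp [hbc])
  have hg : Measurable ((gapMass μ ⁻¹' {0}).indicator fun _ => (1 : ENNReal)) :=
    measurable_const.indicator (measurable_gapMass μ (measurableSet_singleton 0))
  have h := lintegral_between_card hm hi hl hab (T := {c}) (by simpa using hac)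
    (by simpa using hbc) 1 hg
  have h0 : ∀ z, ENNReal.ofReal (binPmf ({c} : Finset ι).card 1 (gapMass μ z))
      * (gapMass μ ⁻¹' {0}).indicator (fun _ => (1 : ENNReal)) z = 0 := by
    intro z
    by_cases hz : gapMass μ z = 0 <;> simp [hz, binPmf]
  simp only [h0, lintegral_zero] at h
  rw [lintegral_eq_zero_iff'] at h
  · filter_upwards [h] with ω hω h1 h2
    refine (gapMass_nonneg μ _).lt_of_ne' fun hz => ?_
    simp [h1, h2, hz] at hω
  · refine Measurable.aemeasurable ?_
    have hs : MeasurableSet {ω | Y a ω < Y c ω ∧ Y c ω < Y b ω} :=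
      (measurableSet_lt (hm a) (hm c)).inter (measurableSet_lt (hm c) (hm b))
    refine Measurable.ite ?_ (hg.comp ((hm a).prodMk (hm b))) measurable_const
    convert hs using 2 with ω
    ext ω
    simp only [Finset.sum_singleton, Set.indicator_apply, Set.mem_Ioo]
    split_ifs with h <;> simp [h]

/-- The expected number of ordered pairs with `j` of `N` further points between them, weighted with
the `q`-th power of the inverse mass of the gap. -/
noncomputable def pairInt (μ : Measure ℝ) (N j q : ℕ) : ENNReal :=
  ∫⁻ z, ENNReal.ofReal (binPmf N j (gapMass μ z)) *
    {z : ℝ × ℝ | z.1 < z.2}.indicator (fun z => ENNReal.ofReal ((gapMass μ z)⁻¹ ^ q)) z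
      ∂(μ.prod μ)

/-- Diagonal pairs contribute nothing, and all (N + 2)(N + 1) others have the same expectation. -/
theorem lintegral_sum_pairs [Fintype ι] [IsProbabilityMeasure P] [IsProbabilityMeasure μ]
    (hm : ∀ i, Measurable (Y i)) (hi : iIndepFun Y P) (hl : ∀ i, P.map (Y i) = μ) {N : ℕ}
    (hN : Fintype.card ι = N + 2) (j q : ℕ) :
    ∫⁻ ω, ∑ a, ∑ b, (if Y a ω < Y b ω ∧ betweenCard (fun i => Y i ω) a b = j then
        ENNReal.ofReal ((gapMass μ (Y a ω, Y b ω))⁻¹ ^ q) else 0) ∂P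
      = (N + 2) * (N + 1) * pairInt μ N j q := by
  classical
  set g : ℝ × ℝ → ENNReal :=
    {z : ℝ × ℝ | z.1 < z.2}.indicator (fun z => ENNReal.ofReal ((gapMass μ z)⁻¹ ^ q)) with hgdef
  have hg : Measurable g := by
    refine Measurable.indicator ?_ (measurableSet_lt measurable_fst measurable_snd)
    exact ((measurable_gapMass μ).inv.pow_const q).ennreal_ofReal
  let F : ι → ι → Ω → ENNReal := fun a b ω =>
    if ∑ c ∈ Finset.univ \ {a, b}, (Set.Ioo (Y a ω) (Y b ω)).indicator (fun _ => 1) (Y c ω) = j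
      then g (Y a ω, Y b ω) else 0
  have hF : ∀ a b ω, (if Y a ω < Y b ω ∧ betweenCard (fun i => Y i ω) a b = j then
      ENNReal.ofReal ((gapMass μ (Y a ω, Y b ω))⁻¹ ^ q) else 0) = F a b ω := by
    intro a b ω
    have hcard : betweenCard (fun i => Y i ω) a b = ∑ c ∈ Finset.univ \ {a, b},
        (Set.Ioo (Y a ω) (Y b ω)).indicator (fun _ => 1) (Y c ω) := by
      unfold betweenCard
      rw [Finset.card_filter, eq_comm]
      refine (Finset.sum_subset (Finset.subset_univ _) fun c _ hc => ?_).trans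
        (Finset.sum_congr rfl fun c _ => Set.indicator_apply _ _ _)
      simp only [Finset.mem_sdiff, Finset.mem_univ, true_and, Finset.mem_insert,
        Finset.mem_singleton, not_not] at hc
      rcases hc with rfl | rfl <;> simp
    simp only [F]
    rw [← hcard]
    simp only [hgdef, Set.indicator_apply, Set.mem_ofPred_eq]
    by_cases h1 : Y a ω < Y b ω <;> simp [h1]
  have hFm : ∀ a b, Measurable (F a b) := by
    intro a b
    refine Measurable.ite ?_ (hg.comp ((hm a).prodMk (hm b))) measurable_const
    refine measurableSet_eq_fun (Finset.measurable_sum _ fun c _ => ?_) measurable_const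
    have hs : MeasurableSet {ω | Y a ω < Y c ω ∧ Y c ω < Y b ω} :=
      (measurableSet_lt (hm a) (hm c)).inter (measurableSet_lt (hm c) (hm b))
    exact Measurable.ite hs measurable_const measurable_const
  have hint : ∀ a b, ∫⁻ ω, F a b ω ∂P = if a = b then 0 else pairInt μ N j q := by
    intro a b
    split_ifs with hab
    · subst hab
      simp [F, hgdef]
    · rw [lintegral_between_card hm hi hl hab (by simp) (by simp) j hg, pairInt,
        Finset.card_sdiff_of_subset (Finset.subset_univ _), Finset.card_univ, hN,
        Finset.card_pair hab]
      rfl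
  simp only [hF]
  rw [lintegral_finsetSum _ fun a _ => Finset.measurable_sum _ fun b _ => hFm a b]
  simp only [lintegral_finsetSum _ fun b _ => hFm _ b, hint]
  have : ∀ a : ι, (∑ b, if a = b then (0 : ENNReal) else pairInt μ N j q)
      = (N + 1) * pairInt μ N j q := by
    intro a
    rw [Finset.sum_ite, Finset.sum_const_zero, zero_add, Finset.sum_const, nsmul_eq_mul]
    congr 1
    rw [Finset.filter_ne, Finset.card_erase_of_mem (Finset.mem_univ _), Finset.card_univ, hN]
    push_cast
    rfl
  simp only [this, Finset.sum_const, Finset.card_univ, hN, nsmul_eq_mul]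
  push_cast
  ring

theorem pairInt_succ_le [IsProbabilityMeasure μ] (N j q : ℕ) :
    pairInt μ (N + 1) (j + 1) (q + 1)
      ≤ ENNReal.ofReal ((N + 1 : ℝ) / (j + 1)) * pairInt μ N j q := by
  unfold pairInt
  rw [← lintegral_const_mul]
  · refine lintegral_mono fun z => ?_
    by_cases hz : z.1 < z.2
    · simp only [Set.indicator_of_mem (s := {z : ℝ × ℝ | z.1 < z.2}) hz]
      have h1 : ∀ N j, 0 ≤ binPmf N j (gapMass μ z) := fun N j =>
        mul_nonneg (mul_nonneg (Nat.cast_nonneg _) (pow_nonneg (gapMass_nonneg μ z) _))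
          (pow_nonneg (by linarith [gapMass_le_one μ z]) _)
      rw [← ENNReal.ofReal_mul (h1 _ _), ← ENNReal.ofReal_mul (h1 _ _),
        ← ENNReal.ofReal_mul (by positivity)]
      exact ENNReal.ofReal_le_ofReal
        (binPmf_succ_mul_inv_le N j q (gapMass_nonneg μ z) (gapMass_le_one μ z))
    · simp [Set.indicator_of_notMem (s := {z : ℝ × ℝ | z.1 < z.2}) hz]
  · refine Measurable.mul ((measurable_binPmf N j).comp (measurable_gapMass μ)).ennreal_ofReal ?_
    refine Measurable.indicator ?_ (measurableSet_lt measurable_fst measurable_snd)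
    exact ((measurable_gapMass μ).inv.pow_const q).ennreal_ofReal

/-- A sample of N + 2 distinct points has at most N + 2 pairs with j points between; divide by the
number of ordered pairs. -/
theorem pairInt_zero_le [Fintype ι] [IsProbabilityMeasure P] [IsProbabilityMeasure μ] [NullSingletonClass μ]
    (hm : ∀ i, Measurable (Y i)) (hi : iIndepFun Y P) (hl : ∀ i, P.map (Y i) = μ) {N : ℕ}
    (hN : Fintype.card ι = N + 2) (j : ℕ) :
    pairInt μ N j 0 ≤ ENNReal.ofReal (1 / (N + 1)) := by
  have h := lintegral_sum_pairs hm hi hl hN j 0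
  have h2 : ((N : ENNReal) + 2) * (N + 1) * pairInt μ N j 0 ≤ N + 2 := by
    rw [← h]
    calc _ ≤ ∫⁻ _, ((N : ENNReal) + 2) ∂P := by
          refine lintegral_mono_ae ?_
          filter_upwards [ae_injective hm hi hl] with ω hω
          have := sum_gap_one_le hω j
          rw [hN] at this
          simpa using this
      _ = _ := by simp
  have h3 : ((N : ENNReal) + 1) * pairInt μ N j 0 ≤ 1 := by
    have h0 : ((N : ENNReal) + 2) ≠ 0 := by positivity
    have ht : ((N : ENNReal) + 2) ≠ ⊤ := by finiteness
    rw [mul_assoc] at h2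
    exact (ENNReal.mul_le_mul_iff_right h0 ht).1 (by simpa using h2)
  rw [one_div, ENNReal.ofReal_inv_of_pos (by positivity), ENNReal.le_inv_iff_mul_le, mul_comm]
  convert h3 using 2
  rw [ENNReal.ofReal_add (by positivity) (by positivity)]
  simp

end iid

theorem pairInt_two_le {Ω : Type*} [MeasurableSpace Ω] {P : Measure Ω} [IsProbabilityMeasure P]
    {μ : Measure ℝ} [IsProbabilityMeasure μ] [NullSingletonClass μ] {Y : ℕ → Ω → ℝ}
    (hm : ∀ i, Measurable (Y i)) (hi : iIndepFun Y P) (hl : ∀ i, P.map (Y i) = μ) (N j : ℕ) :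
    pairInt μ (N + 2) (j + 2) 2
      ≤ ENNReal.ofReal (((N : ℝ) + 2) / (((j : ℝ) + 2) * (j + 1))) := by
  have h0 : pairInt μ N j 0 ≤ ENNReal.ofReal (1 / (N + 1)) :=
    pairInt_zero_le (Y := fun i : Fin (N + 2) => Y i) (fun i => hm i)
      (hi.precomp Fin.val_injective) (fun i => hl i) (by simp) j
  have h1 := pairInt_succ_le (μ := μ) N j 0
  have h2 := pairInt_succ_le (μ := μ) (N + 1) (j + 1) 1
  refine h2.trans ((mul_le_mul_right (h1.trans (mul_le_mul_right h0 _)) _).trans ?_)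
  rw [← ENNReal.ofReal_mul (by positivity), ← ENNReal.ofReal_mul (by positivity)]
  apply ENNReal.ofReal_le_ofReal
  push_cast
  apply le_of_eq
  field_simp
  ring

theorem pairInt_three_le {Ω : Type*} [MeasurableSpace Ω] {P : Measure Ω} [IsProbabilityMeasure P]
    {μ : Measure ℝ} [IsProbabilityMeasure μ] [NullSingletonClass μ] {Y : ℕ → Ω → ℝ}
    (hm : ∀ i, Measurable (Y i)) (hi : iIndepFun Y P) (hl : ∀ i, P.map (Y i) = μ) (N j : ℕ) :
    pairInt μ (N + 3) (j + 3) 3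
      ≤ ENNReal.ofReal (((N : ℝ) + 3) * (N + 2) / (((j : ℝ) + 3) * (j + 2) * (j + 1))) := by
  have h1 := pairInt_two_le hm hi hl N j
  have h2 := pairInt_succ_le (μ := μ) (N + 2) (j + 2) 2
  refine h2.trans ((mul_le_mul_right h1 _).trans ?_)
  rw [← ENNReal.ofReal_mul (by positivity)]
  apply ENNReal.ofReal_le_ofReal
  push_cast
  apply le_of_eq
  field_simp
  ring

/-- The sum of the `q`-th powers of the inverse masses of the `k`-spacings of a sample. -/
noncomputable def invSpacingSum (μ : Measure ℝ) (k q : ℕ) {n : ℕ} (x : Fin n → ℝ) : ℝ :=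
  ∑ l ∈ Finset.Icc 1 (n - k),
    (gapMass μ (orderStat x (l : ℤ), orderStat x ((l + k : ℕ) : ℤ)))⁻¹ ^ q

theorem invSpacingSum_nonneg (μ : Measure ℝ) (k q : ℕ) {n : ℕ} (x : Fin n → ℝ) :
    0 ≤ invSpacingSum μ k q x :=
  Finset.sum_nonneg fun _ _ => pow_nonneg (inv_nonneg.2 (gapMass_nonneg _ _)) _

theorem measurable_invSpacingSum (μ : Measure ℝ) [IsProbabilityMeasure μ] (k q n : ℕ) :
    Measurable fun x : Fin n → ℝ => invSpacingSum μ k q x := by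
  unfold invSpacingSum
  refine Finset.measurable_sum _ fun l _ => ?_
  exact ((measurable_gapMass μ).comp
    ((measurable_orderStat n _).prodMk (measurable_orderStat n _))).inv.pow_const q

section iid

variable {Ω : Type*} [MeasurableSpace Ω] {P : Measure Ω} [IsProbabilityMeasure P]
  {μ : Measure ℝ} [IsProbabilityMeasure μ] [NullSingletonClass μ] {Y : ℕ → Ω → ℝ}

theorem lintegral_invSpacingSum_le (hm : ∀ i, Measurable (Y i)) (hi : iIndepFun Y P)
    (hl : ∀ i, P.map (Y i) = μ) (N j q : ℕ) :
    ∫⁻ ω, ENNReal.ofReal (invSpacingSum μ (j + 1) q fun i : Fin (N + 2) => Y i ω) ∂P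
      ≤ (N + 2) * (N + 1) * pairInt μ N j q := by
  rw [← lintegral_sum_pairs (Y := fun i : Fin (N + 2) => Y i) (fun i => hm i)
    (hi.precomp Fin.val_injective) (fun i => hl i) (by simp) j q]
  refine lintegral_mono_ae ?_
  filter_upwards [ae_injective hm hi hl] with ω hω
  have hinj : Function.Injective fun i : Fin (N + 2) => Y i ω := hω.comp Fin.val_injective
  unfold invSpacingSum
  rw [ENNReal.ofReal_sum_of_nonneg
    fun _ _ => pow_nonneg (inv_nonneg.2 (gapMass_nonneg _ _)) _]
  exact sum_orderStat_gap_le hinj j fun a b => ENNReal.ofReal ((gapMass μ (a, b))⁻¹ ^ q)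

/-- The leading constant 1 in n(n/k)² matters: it cancels exactly in the interior estimate. For the
third moment only the order of magnitude is used. -/
theorem lintegral_invSpacingSum_two_le (hm : ∀ i, Measurable (Y i)) (hi : iIndepFun Y P)
    (hl : ∀ i, P.map (Y i) = μ) {n k : ℕ} (hk : 3 ≤ k) (hn : 4 ≤ n) :
    ∫⁻ ω, ENNReal.ofReal (invSpacingSum μ k 2 fun i : Fin n => Y i ω) ∂P
      ≤ ENNReal.ofReal ((n : ℝ) ^ 3 / (((k : ℝ) - 1) * (k - 2))) := by
  obtain ⟨N, rfl⟩ := Nat.exists_eq_add_of_le' hn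
  obtain ⟨j, rfl⟩ := Nat.exists_eq_add_of_le' hk
  refine (lintegral_invSpacingSum_le hm hi hl (N + 2) (j + 2) 2).trans ?_
  refine (mul_le_mul_right (pairInt_two_le hm hi hl N j) _).trans ?_
  have : ((N + 2 : ℕ) + 2 : ENNReal) * ((N + 2 : ℕ) + 1)
      = ENNReal.ofReal (((N : ℝ) + 4) * (N + 3)) := by
    have h : ((N : ℝ) + 4) * (N + 3) = (((N + 4) * (N + 3) : ℕ) : ℝ) := by push_cast; ring
    rw [h, ENNReal.ofReal_natCast]
    push_cast
    ring
  rw [this, ← ENNReal.ofReal_mul (by positivity)]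
  apply ENNReal.ofReal_le_ofReal
  push_cast
  rw [show (j : ℝ) + 3 - 1 = j + 2 by ring, show (j : ℝ) + 3 - 2 = j + 1 by ring, ← mul_div_assoc]
  gcongr
  calc ((N : ℝ) + 4) * (N + 3) * (N + 2) ≤ (N + 4) * (N + 4) * (N + 4) := by gcongr <;> norm_num
    _ = _ := by ring

theorem lintegral_invSpacingSum_three_le (hm : ∀ i, Measurable (Y i)) (hi : iIndepFun Y P)
    (hl : ∀ i, P.map (Y i) = μ) {n k : ℕ} (hk : 4 ≤ k) (hn : 5 ≤ n) :
    ∫⁻ ω, ENNReal.ofReal (invSpacingSum μ k 3 fun i : Fin n => Y i ω) ∂P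
      ≤ ENNReal.ofReal ((n : ℝ) ^ 4 / (((k : ℝ) - 1) * (k - 2) * (k - 3))) := by
  obtain ⟨N, rfl⟩ := Nat.exists_eq_add_of_le' hn
  obtain ⟨j, rfl⟩ := Nat.exists_eq_add_of_le' hk
  refine (lintegral_invSpacingSum_le hm hi hl (N + 3) (j + 3) 3).trans ?_
  refine (mul_le_mul_right (pairInt_three_le hm hi hl N j) _).trans ?_
  have : ((N + 3 : ℕ) + 2 : ENNReal) * ((N + 3 : ℕ) + 1)
      = ENNReal.ofReal (((N : ℝ) + 5) * (N + 4)) := by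
    have h : ((N : ℝ) + 5) * (N + 4) = (((N + 5) * (N + 4) : ℕ) : ℝ) := by push_cast; ring
    rw [h, ENNReal.ofReal_natCast]
    push_cast
    ring
  rw [this, ← ENNReal.ofReal_mul (by positivity)]
  apply ENNReal.ofReal_le_ofReal
  push_cast
  rw [show (j : ℝ) + 4 - 1 = j + 3 by ring, show (j : ℝ) + 4 - 2 = j + 2 by ring,
    show (j : ℝ) + 4 - 3 = j + 1 by ring, ← mul_div_assoc]
  gcongr
  calc ((N : ℝ) + 5) * (N + 4) * ((N + 3) * (N + 2))
      ≤ (N + 5) * (N + 5) * ((N + 5) * (N + 5)) := by gcongr <;> norm_num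
    _ = _ := by ring

end iid

/-! ### Normalised spacings -/

theorem one_le_spacingWeight {m n i : ℕ} (h1 : 1 ≤ i) (hn : i ≤ n) : 1 ≤ spacingWeight m n i := by
  have h1' : (1 : ℝ) ≤ i := by exact_mod_cast h1
  have hn' : (i : ℝ) ≤ n := by exact_mod_cast hn
  unfold spacingWeight
  split_ifs
  · have : 0 ≤ ((i : ℝ) - 1) / m := div_nonneg (by linarith) (Nat.cast_nonneg _)
    linarith
  · norm_num
  · have : 0 ≤ ((n : ℝ) - i) / m := div_nonneg (by linarith) (Nat.cast_nonneg _)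
    linarith

theorem spacingWeight_le_two {m n i : ℕ} : spacingWeight m n i ≤ 2 := by
  unfold spacingWeight
  split_ifs with h1 h2
  · have : ((i : ℝ) - 1) / m ≤ 1 := by
      apply div_le_one_of_le₀ _ (Nat.cast_nonneg _)
      have : (i : ℝ) ≤ m := by exact_mod_cast h1
      linarith
    linarith
  · exact le_rfl
  · have : ((n : ℝ) - i) / m ≤ 1 := by
      apply div_le_one_of_le₀ _ (Nat.cast_nonneg _)
      have : (n : ℝ) ≤ i + m := by exact_mod_cast (not_le.1 h2).le
      linarith
    linarith

/-- The reciprocal of the normalised mass of the `i`-th window. -/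
noncomputable def normSpacing (μ : Measure ℝ) (m : ℕ) {n : ℕ} (x : Fin n → ℝ) (i : ℕ) : ℝ :=
  (spacingWeight m n i * ((m : ℝ) / n)) /
    gapMass μ (orderStat x ((i : ℤ) - m), orderStat x ((i : ℤ) + m))

/-- The mean square deviation of the normalised spacings from `1`. -/
noncomputable def spacingDeviation (μ : Measure ℝ) (m : ℕ) {n : ℕ} (x : Fin n → ℝ) : ℝ :=
  (1 / (n : ℝ)) * ∑ i ∈ Finset.Icc 1 n, (normSpacing μ m x i - 1) ^ 2

/-- The sample is in general position with respect to `μ`: there are no ties, and two sample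
points with another one between them enclose positive mass. -/
structure GenericSample (μ : Measure ℝ) {n : ℕ} (x : Fin n → ℝ) : Prop where
  injective : Function.Injective x
  pos : ∀ a b c, x a < x c → x c < x b → 0 < gapMass μ (x a, x b)

theorem gapMass_mono (μ : Measure ℝ) [IsProbabilityMeasure μ] {a b c d : ℝ} (h1 : c ≤ a)
    (h2 : b ≤ d) : gapMass μ (a, b) ≤ gapMass μ (c, d) :=
  measureReal_mono (Set.Ioo_subset_Ioo h1 h2)

theorem gapMass_le_sub (μ : Measure ℝ) [IsProbabilityMeasure μ] {a b : ℝ} (h : a ≤ b) :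
    gapMass μ (a, b) ≤ μ.real (Set.Iic b) - μ.real (Set.Iic a) := by
  rw [← measureReal_sdiff (Set.Iic_subset_Iic.2 h) measurableSet_Iic]
  refine measureReal_mono fun t ht => ⟨ht.2.le, not_le.2 ht.1⟩

theorem exists_orderStat_eq {n : ℕ} (hn : 0 < n) (x : Fin n → ℝ) (i : ℤ) :
    ∃ a, orderStat x i = x a := by
  unfold orderStat
  rw [dif_pos hn]
  exact ⟨_, rfl⟩

theorem GenericSample.gapMass_pos {μ : Measure ℝ} {n : ℕ} {x : Fin n → ℝ}
    (hx : GenericSample μ x) (hn : 2 ≤ n) {i j : ℤ} (c : ℤ) (hic : i < c) (hcj : c < j)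
    (h1 : 1 < c) (hcn : c < n) : 0 < gapMass μ (orderStat x i, orderStat x j) := by
  have l1 := orderStat_lt hx.injective hn hic (hic.trans hcn) h1
  have l2 := orderStat_lt hx.injective hn hcj hcn (h1.trans hcj)
  obtain ⟨a, ha⟩ := exists_orderStat_eq (by omega) x i
  obtain ⟨b, hb⟩ := exists_orderStat_eq (by omega) x j
  obtain ⟨d, hd⟩ := exists_orderStat_eq (by omega) x c
  rw [ha, hd] at l1
  rw [hb, hd] at l2
  rw [ha, hb]
  exact hx.pos a b d l1 l2

theorem GenericSample.window_pos {μ : Measure ℝ} {n m : ℕ} {x : Fin n → ℝ}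
    (hx : GenericSample μ x) (hm : 2 ≤ m) (hmn : 2 * m < n) {i : ℕ} (h1 : 1 ≤ i) (hn : i ≤ n) :
    0 < gapMass μ (orderStat x ((i : ℤ) - m), orderStat x ((i : ℤ) + m)) :=
  hx.gapMass_pos (by omega) (max 2 (min i (n - 1))) (by omega) (by omega) (by omega) (by omega)

/-- Window masses are at most increments of the distribution function, whose sum telescopes. -/
theorem sum_window_gapMass_le (μ : Measure ℝ) [IsProbabilityMeasure μ] (m : ℕ) {n : ℕ}
    (x : Fin n → ℝ) :
    ∑ i ∈ Finset.Icc 1 n, gapMass μ (orderStat x ((i : ℤ) - m), orderStat x ((i : ℤ) + m))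
      ≤ 2 * m := by
  have h := sum_window_le (a := fun i => μ.real (Set.Iic (orderStat x i))) 0 1
    (fun _ => measureReal_nonneg) (fun _ => measureReal_le_one) m n
  calc _ ≤ _ := Finset.sum_le_sum fun i _ =>
        gapMass_le_sub μ (orderStat_monotone x (by omega))
    _ ≤ _ := h
    _ = _ := by ring

theorem normSpacing_nonneg (μ : Measure ℝ) (m : ℕ) {n : ℕ} (x : Fin n → ℝ) {i : ℕ} (h1 : 1 ≤ i)
    (hn : i ≤ n) : 0 ≤ normSpacing μ m x i := by
  have := one_le_spacingWeight (m := m) h1 hn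
  exact div_nonneg (by positivity) (gapMass_nonneg _ _)

theorem sq_le_sq_add_cube_div {y T : ℝ} (hy : 0 ≤ y) (hT : 0 < T) : y ^ 2 ≤ T ^ 2 + y ^ 3 / T := by
  rcases le_total y T with h | h
  · have : 0 ≤ y ^ 3 / T := by positivity
    nlinarith
  · have : y ^ 2 ≤ y ^ 3 / T := by
      rw [le_div_iff₀ hT, pow_succ y 2]
      gcongr
    nlinarith [sq_nonneg T]

theorem edge_term_le {μ : Measure ℝ} {m n : ℕ} {x : Fin n → ℝ} {i : ℕ} (h1 : 1 ≤ i)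
    (hin : i ≤ n) {H T : ℝ} (hT : 0 < T) (hH : 0 < H)
    (hle : H ≤ gapMass μ (orderStat x ((i : ℤ) - m), orderStat x ((i : ℤ) + m))) :
    (normSpacing μ m x i - 1) ^ 2 ≤ (T ^ 2 + 1) + 8 / T * ((m : ℝ) / n) ^ 3 * H⁻¹ ^ 3 := by
  have hy := normSpacing_nonneg μ m x h1 hin
  have hw := one_le_spacingWeight (m := m) h1 hin
  have h2 : normSpacing μ m x i ≤ 2 * ((m : ℝ) / n) * H⁻¹ := by
    unfold normSpacing
    rw [← div_eq_mul_inv]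
    have := spacingWeight_le_two (m := m) (n := n) (i := i)
    gcongr
  have h3 : normSpacing μ m x i ^ 3 / T ≤ 8 / T * ((m : ℝ) / n) ^ 3 * H⁻¹ ^ 3 := by
    calc _ ≤ (2 * ((m : ℝ) / n) * H⁻¹) ^ 3 / T := by gcongr
      _ = _ := by ring
  nlinarith [sq_le_sq_add_cube_div hy hT]

/-- Equivalent to y + 1/y ≥ 2. It trades the mean of y, which would need a lower bound, for the mean
of 1/y, which telescopes. -/
theorem sub_one_sq_le {y : ℝ} (hy : 0 < y) : (y - 1) ^ 2 ≤ y ^ 2 + 2 * y⁻¹ - 3 := by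
  have : y ^ 2 + 2 * y⁻¹ - 3 - (y - 1) ^ 2 = 2 * (y - 1) ^ 2 / y := by
    field_simp
    ring
  have h2 : 0 ≤ 2 * (y - 1) ^ 2 / y := by positivity
  linarith

theorem sum_Icc_shift (φ : ℕ → ℝ) (a b m : ℕ) :
    ∑ i ∈ Finset.Icc (a + m) (b + m), φ i = ∑ l ∈ Finset.Icc a b, φ (l + m) := by
  rw [← Finset.map_add_right_Icc, Finset.sum_map]
  rfl

theorem GenericSample.interior_le {μ : Measure ℝ} [IsProbabilityMeasure μ] {m n : ℕ}
    {x : Fin n → ℝ} (hx : GenericSample μ x) (hm : 2 ≤ m) (hmn : 2 * m < n) :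
    ∑ i ∈ Finset.Icc (m + 1) (n - m), (normSpacing μ m x i - 1) ^ 2
      ≤ (2 * (m : ℝ) / n) ^ 2 * invSpacingSum μ (2 * m) 2 x + 2 * n - 3 * (n - 2 * m) := by
  set H : ℕ → ℝ := fun i =>
    gapMass μ (orderStat x ((i : ℤ) - m), orderStat x ((i : ℤ) + m)) with hH
  have hm0 : (0 : ℝ) < m := by exact_mod_cast (by omega : 0 < m)
  have hn0 : (0 : ℝ) < n := by exact_mod_cast (by omega : 0 < n)
  have hterm : ∀ i ∈ Finset.Icc (m + 1) (n - m), (normSpacing μ m x i - 1) ^ 2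
      ≤ (2 * (m : ℝ) / n) ^ 2 * (H i)⁻¹ ^ 2 + (n / m) * H i - 3 := by
    intro i hi
    rw [Finset.mem_Icc] at hi
    have hHi : 0 < H i := hx.window_pos hm hmn (by omega) (by omega)
    have hY : normSpacing μ m x i = 2 * (m : ℝ) / n * (H i)⁻¹ := by
      unfold normSpacing spacingWeight
      rw [if_neg (by omega), if_pos (by omega)]
      rw [div_eq_mul_inv]
      ring
    rw [hY]
    refine (sub_one_sq_le (by positivity)).trans (le_of_eq ?_)
    field_simp
  have hsumH : ∑ i ∈ Finset.Icc (m + 1) (n - m), H i ≤ 2 * m :=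
    (Finset.sum_le_sum_of_subset_of_nonneg (Finset.Icc_subset_Icc (by omega) (by omega))
      fun i _ _ => gapMass_nonneg _ _).trans (sum_window_gapMass_le μ m x)
  have hS : ∑ i ∈ Finset.Icc (m + 1) (n - m), (H i)⁻¹ ^ 2 = invSpacingSum μ (2 * m) 2 x := by
    have h := sum_Icc_shift (fun i => (H i)⁻¹ ^ 2) 1 (n - 2 * m) m
    rw [show 1 + m = m + 1 by ring, show n - 2 * m + m = n - m by omega] at h
    rw [h]
    unfold invSpacingSum
    refine Finset.sum_congr rfl fun l _ => ?_
    simp only [hH]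
    congr 5
    · push_cast; ring
    · push_cast; ring
  have hcard : ((Finset.Icc (m + 1) (n - m)).card : ℝ) = n - 2 * m := by
    rw [Nat.card_Icc, show n - m + 1 - (m + 1) = n - 2 * m by omega, Nat.cast_sub hmn.le]
    push_cast
    rfl
  calc _ ≤ ∑ i ∈ Finset.Icc (m + 1) (n - m),
        ((2 * (m : ℝ) / n) ^ 2 * (H i)⁻¹ ^ 2 + (n / m) * H i - 3) := Finset.sum_le_sum hterm
    _ = (2 * (m : ℝ) / n) ^ 2 * invSpacingSum μ (2 * m) 2 x
        + (n / m) * ∑ i ∈ Finset.Icc (m + 1) (n - m), H i - 3 * (n - 2 * m) := by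
      rw [Finset.sum_sub_distrib, Finset.sum_add_distrib, ← Finset.mul_sum, ← Finset.mul_sum, hS,
        Finset.sum_const, nsmul_eq_mul, hcard]
      ring
    _ ≤ _ := by
      have : (n / m) * ∑ i ∈ Finset.Icc (m + 1) (n - m), H i ≤ (n / m : ℝ) * (2 * m) := by gcongr
      have h2 : (n / m : ℝ) * (2 * m) = 2 * n := by field_simp
      linarith

theorem GenericSample.left_le {μ : Measure ℝ} [IsProbabilityMeasure μ] {m n : ℕ}
    {x : Fin n → ℝ} (hx : GenericSample μ x) (hm : 2 ≤ m) (hmn : 2 * m < n) {T : ℝ} (hT : 0 < T) :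
    ∑ i ∈ Finset.Icc 1 m, (normSpacing μ m x i - 1) ^ 2
      ≤ m * (T ^ 2 + 1) + 8 / T * ((m : ℝ) / n) ^ 3 * invSpacingSum μ m 3 x := by
  calc _ ≤ ∑ i ∈ Finset.Icc 1 m, ((T ^ 2 + 1) + 8 / T * ((m : ℝ) / n) ^ 3 *
        (gapMass μ (orderStat x (i : ℤ), orderStat x ((i + m : ℕ) : ℤ)))⁻¹ ^ 3) := by
        refine Finset.sum_le_sum fun i hi => ?_
        rw [Finset.mem_Icc] at hi
        -- The window contains the m-spacing from rank i to i + m, whose mass is positive because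
        -- rank i + 1 lies strictly inside when m ≥ 2.
        refine edge_term_le hi.1 (by omega) hT
          (hx.gapMass_pos (by omega) ((i : ℤ) + 1) (by omega) (by push_cast; omega) (by omega)
            (by omega)) (gapMass_mono μ (orderStat_monotone x (by omega)) (le_of_eq ?_))
        push_cast
        rfl
    _ ≤ _ := by
        rw [Finset.sum_add_distrib, Finset.sum_const, nsmul_eq_mul, Nat.card_Icc, ← Finset.mul_sum]
        unfold invSpacingSum
        gcongr
        · simp
        · exact fun i _ _ => pow_nonneg (inv_nonneg.2 (gapMass_nonneg _ _)) _
        · omega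

theorem GenericSample.right_le {μ : Measure ℝ} [IsProbabilityMeasure μ] {m n : ℕ}
    {x : Fin n → ℝ} (hx : GenericSample μ x) (hm : 2 ≤ m) (hmn : 2 * m < n) {T : ℝ} (hT : 0 < T) :
    ∑ i ∈ Finset.Icc (n - m + 1) n, (normSpacing μ m x i - 1) ^ 2
      ≤ m * (T ^ 2 + 1) + 8 / T * ((m : ℝ) / n) ^ 3 * invSpacingSum μ m 3 x := by
  have h := sum_Icc_shift (fun i => (normSpacing μ m x i - 1) ^ 2) (n - 2 * m + 1) (n - m) m
  rw [show n - 2 * m + 1 + m = n - m + 1 by omega, show n - m + m = n by omega] at h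
  rw [h]
  calc _ ≤ ∑ l ∈ Finset.Icc (n - 2 * m + 1) (n - m), ((T ^ 2 + 1) + 8 / T * ((m : ℝ) / n) ^ 3 *
        (gapMass μ (orderStat x (l : ℤ), orderStat x ((l + m : ℕ) : ℤ)))⁻¹ ^ 3) := by
        refine Finset.sum_le_sum fun l hl => ?_
        rw [Finset.mem_Icc] at hl
        refine edge_term_le (by omega) (by omega) hT
          (hx.gapMass_pos (by omega) ((l : ℤ) + 1) (by omega) (by push_cast; omega) (by omega)
            (by omega)) (gapMass_mono μ (le_of_eq ?_) (orderStat_monotone x (by omega)))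
        congr 1
        push_cast
        ring
    _ ≤ _ := by
        rw [Finset.sum_add_distrib, Finset.sum_const, nsmul_eq_mul, Nat.card_Icc, ← Finset.mul_sum]
        unfold invSpacingSum
        gcongr
        · omega
        · exact fun i _ _ => pow_nonneg (inv_nonneg.2 (gapMass_nonneg _ _)) _
        · omega

/-- The interior constants give 2n - 3(n - 2m) = -n + 6m. The -n becomes the 1 on the left, which
avoids subtraction in `ENNReal`; the 8 is 6 plus 1 from each edge. -/
theorem GenericSample.spacingDeviation_le {μ : Measure ℝ} [IsProbabilityMeasure μ] {m n : ℕ}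
    {x : Fin n → ℝ} (hx : GenericSample μ x) (hm : 2 ≤ m) (hmn : 2 * m < n) {T : ℝ} (hT : 0 < T) :
    spacingDeviation μ m x + 1 ≤ (1 / n * (2 * (m : ℝ) / n) ^ 2) * invSpacingSum μ (2 * m) 2 x
      + (1 / n * (16 / T * ((m : ℝ) / n) ^ 3)) * invSpacingSum μ m 3 x
      + ((m : ℝ) / n) * (2 * T ^ 2 + 8) := by
  have hn0 : (0 : ℝ) < n := by exact_mod_cast (by omega : 0 < n)
  have hsplit : ∑ i ∈ Finset.Icc 1 n, (normSpacing μ m x i - 1) ^ 2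
      = ∑ i ∈ Finset.Icc 1 m, (normSpacing μ m x i - 1) ^ 2
        + ∑ i ∈ Finset.Icc (m + 1) (n - m), (normSpacing μ m x i - 1) ^ 2
        + ∑ i ∈ Finset.Icc (n - m + 1) n, (normSpacing μ m x i - 1) ^ 2 := by
    have hI : ∀ a b : ℕ, Finset.Icc (a + 1) b = Finset.Ioc a b := fun a b => by
      ext; simp
    rw [hI, hI, show (1 : ℕ) = 0 + 1 from rfl, hI, hI,
      Finset.sum_Ioc_consecutive _ (by omega) (by omega),
      Finset.sum_Ioc_consecutive _ (by omega) (by omega)]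
  have h := add_le_add (add_le_add (hx.left_le hm hmn hT) (hx.interior_le hm hmn))
    (hx.right_le hm hmn hT)
  rw [← hsplit] at h
  have h2 := mul_le_mul_of_nonneg_left h (by positivity : 0 ≤ 1 / (n : ℝ))
  unfold spacingDeviation
  refine (add_le_add_left h2 1).trans (le_of_eq ?_)
  field_simp
  ring

theorem measurable_normSpacing (μ : Measure ℝ) [IsProbabilityMeasure μ] (m n i : ℕ) :
    Measurable fun x : Fin n → ℝ => normSpacing μ m x i := by
  unfold normSpacing
  exact ((measurable_gapMass μ).comp
    ((measurable_orderStat n _).prodMk (measurable_orderStat n _))).const_div _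

theorem measurable_spacingDeviation (μ : Measure ℝ) [IsProbabilityMeasure μ] (m n : ℕ) :
    Measurable fun x : Fin n → ℝ => spacingDeviation μ m x := by
  unfold spacingDeviation
  exact (Finset.measurable_sum _ fun i _ =>
    ((measurable_normSpacing μ m n i).sub_const 1).pow_const 2).const_mul _

theorem spacingDeviation_nonneg (μ : Measure ℝ) (m : ℕ) {n : ℕ} (x : Fin n → ℝ) :
    0 ≤ spacingDeviation μ m x :=
  mul_nonneg (by positivity) (Finset.sum_nonneg fun _ _ => sq_nonneg _)

section iid

variable {Ω : Type*} [MeasurableSpace Ω] {P : Measure Ω} [IsProbabilityMeasure P]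
  {μ : Measure ℝ} [IsProbabilityMeasure μ] [NullSingletonClass μ] {Y : ℕ → Ω → ℝ}

theorem ae_genericSample (hm : ∀ i, Measurable (Y i)) (hi : iIndepFun Y P)
    (hl : ∀ i, P.map (Y i) = μ) :
    ∀ᵐ ω ∂P, ∀ n : ℕ, GenericSample μ fun j : Fin n => Y j ω := by
  filter_upwards [ae_injective hm hi hl, ae_gapMass_pos hm hi hl] with ω h1 h2 n
  exact ⟨h1.comp Fin.val_injective, fun a b c => h2 a b c⟩

theorem lintegral_spacingDeviation_le (hm : ∀ i, Measurable (Y i)) (hi : iIndepFun Y P)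
    (hl : ∀ i, P.map (Y i) = μ) {m n : ℕ} (hm6 : 6 ≤ m) (hmn : 2 * m < n) {T : ℝ} (hT : 0 < T) :
    ∫⁻ ω, ENNReal.ofReal (spacingDeviation μ m fun j : Fin n => Y j ω) ∂P + 1
      ≤ ENNReal.ofReal ((2 * (m : ℝ)) ^ 2 / ((2 * m - 1) * (2 * m - 2)) + 128 / T
        + ((m : ℝ) / n) * (2 * T ^ 2 + 8)) := by
  have hn0 : (0 : ℝ) < n := by exact_mod_cast (by omega : 0 < n)
  have hm6' : (6 : ℝ) ≤ m := by exact_mod_cast hm6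
  have hsample : Measurable fun ω => fun j : Fin n => Y j ω :=
    measurable_pi_lambda _ fun j => hm j
  have hS : ∀ k q, Measurable fun ω =>
      ENNReal.ofReal (invSpacingSum μ k q fun j : Fin n => Y j ω) := fun k q =>
    ((measurable_invSpacingSum μ k q n).comp hsample).ennreal_ofReal
  have hD : Measurable fun ω => ENNReal.ofReal (spacingDeviation μ m fun j : Fin n => Y j ω) :=
    ((measurable_spacingDeviation μ m n).comp hsample).ennreal_ofReal
  set A : ℝ := 1 / n * (2 * (m : ℝ) / n) ^ 2 with hA
  set B : ℝ := 1 / n * (16 / T * ((m : ℝ) / n) ^ 3) with hB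
  set C : ℝ := ((m : ℝ) / n) * (2 * T ^ 2 + 8) with hC
  have hA0 : 0 ≤ A := by positivity
  have hB0 : 0 ≤ B := by positivity
  have hC0 : 0 ≤ C := by positivity
  have hd1 : (0 : ℝ) < (2 * m - 1) * (2 * m - 2) := mul_pos (by linarith) (by linarith)
  have hd2 : (0 : ℝ) < (m - 1) * (m - 2) * (m - 3) :=
    mul_pos (mul_pos (by linarith) (by linarith)) (by linarith)
  calc _ = ∫⁻ ω, (ENNReal.ofReal (spacingDeviation μ m fun j : Fin n => Y j ω) + 1) ∂P := by
        rw [lintegral_add_left hD]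
        simp
    _ ≤ ∫⁻ ω, (ENNReal.ofReal A * ENNReal.ofReal (invSpacingSum μ (2 * m) 2 fun j : Fin n => Y j ω)
          + ENNReal.ofReal B * ENNReal.ofReal (invSpacingSum μ m 3 fun j : Fin n => Y j ω)
          + ENNReal.ofReal C) ∂P := by
        refine lintegral_mono_ae ?_
        filter_upwards [ae_genericSample hm hi hl] with ω hω
        have h := (hω n).spacingDeviation_le (by omega) hmn hT
        have h1 := invSpacingSum_nonneg μ (2 * m) 2 fun j : Fin n => Y j ω
        have h2 := invSpacingSum_nonneg μ m 3 fun j : Fin n => Y j ω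
        rw [← ENNReal.ofReal_mul hA0, ← ENNReal.ofReal_mul hB0,
          ← ENNReal.ofReal_add (by positivity) (by positivity),
          ← ENNReal.ofReal_add (by positivity) hC0, ← ENNReal.ofReal_one,
          ← ENNReal.ofReal_add (spacingDeviation_nonneg _ _ _) zero_le_one]
        exact ENNReal.ofReal_le_ofReal h
    _ = ENNReal.ofReal A * ∫⁻ ω, ENNReal.ofReal (invSpacingSum μ (2 * m) 2 fun j : Fin n => Y j ω) ∂P
          + ENNReal.ofReal B * ∫⁻ ω, ENNReal.ofReal (invSpacingSum μ m 3 fun j : Fin n => Y j ω) ∂P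
          + ENNReal.ofReal C := by
        rw [lintegral_add_right _ measurable_const, lintegral_add_left ((hS _ _).const_mul _),
          lintegral_const_mul _ (hS _ _), lintegral_const_mul _ (hS _ _)]
        simp
    _ ≤ ENNReal.ofReal A * ENNReal.ofReal ((n : ℝ) ^ 3 / ((2 * m - 1) * (2 * m - 2)))
          + ENNReal.ofReal B * ENNReal.ofReal ((n : ℝ) ^ 4 / ((m - 1) * (m - 2) * (m - 3)))
          + ENNReal.ofReal C := by
        gcongr
        · have := lintegral_invSpacingSum_two_le hm hi hl (n := n) (k := 2 * m) (by omega) (by omega)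
          push_cast at this
          exact this
        · exact lintegral_invSpacingSum_three_le hm hi hl (by omega) (by omega)
    _ ≤ _ := by
        rw [← ENNReal.ofReal_mul hA0, ← ENNReal.ofReal_mul hB0,
          ← ENNReal.ofReal_add (by positivity) (by positivity),
          ← ENNReal.ofReal_add (by positivity) hC0]
        apply ENNReal.ofReal_le_ofReal
        have e1 : A * ((n : ℝ) ^ 3 / ((2 * m - 1) * (2 * m - 2)))
            = (2 * (m : ℝ)) ^ 2 / ((2 * m - 1) * (2 * m - 2)) := by
          rw [hA]
          field_simp
        have e2 : B * ((n : ℝ) ^ 4 / ((m - 1) * (m - 2) * (m - 3))) ≤ 128 / T := by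
          have : B * ((n : ℝ) ^ 4 / ((m - 1) * (m - 2) * (m - 3)))
              = 16 / T * ((m : ℝ) ^ 3 / ((m - 1) * (m - 2) * (m - 3))) := by
            rw [hB]
            field_simp
          rw [this]
          -- Each factor is at least m / 2 since m ≥ 6.
          have h8 : (m : ℝ) ^ 3 / ((m - 1) * (m - 2) * (m - 3)) ≤ 8 := by
            rw [div_le_iff₀ hd2]
            calc (m : ℝ) ^ 3 = m * m * m := by ring
              _ ≤ (2 * (m - 1)) * (2 * (m - 2)) * (2 * (m - 3)) :=
                mul_le_mul (mul_le_mul (by linarith) (by linarith) (by linarith) (by linarith))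
                  (by linarith) (by linarith) (mul_nonneg (by linarith) (by linarith))
              _ = _ := by ring
          calc _ ≤ 16 / T * 8 := by gcongr
            _ = _ := by ring
        linarith

theorem tendstoInMeasure_spacingDeviation (hm : ∀ i, Measurable (Y i)) (hi : iIndepFun Y P)
    (hl : ∀ i, P.map (Y i) = μ) {m : ℕ → ℕ} (hmt : Tendsto m atTop atTop)
    (hmn : Tendsto (fun n : ℕ => (m n : ℝ) / n) atTop (𝓝 0)) :
    TendstoInMeasure P (fun n ω => spacingDeviation μ (m n) fun j : Fin n => Y j ω) atTop
      (fun _ => 0) := by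
  have hsample : ∀ n : ℕ, Measurable fun ω => fun j : Fin n => Y j ω := fun n =>
    measurable_pi_lambda _ fun j => hm j
  refine tendstoInMeasure_of_tendsto_eLpNorm one_ne_zero
    (fun n => ((measurable_spacingDeviation μ (m n) n).comp (hsample n)).aestronglyMeasurable)
    aestronglyMeasurable_const ?_
  have hnorm : ∀ n : ℕ, eLpNorm
      ((fun ω => spacingDeviation μ (m n) fun j : Fin n => Y j ω) - fun _ => (0 : ℝ)) 1 P
      = ∫⁻ ω, ENNReal.ofReal (spacingDeviation μ (m n) fun j : Fin n => Y j ω) ∂P := by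
    intro n
    rw [eLpNorm_one_eq_lintegral_enorm]
    refine lintegral_congr fun ω => ?_
    rw [Pi.sub_apply, sub_zero, Real.enorm_of_nonneg (spacingDeviation_nonneg _ _ _)]
  simp only [hnorm]
  rw [ENNReal.tendsto_nhds_zero]
  intro ε hε
  obtain ⟨η, hη0, hηε⟩ : ∃ η : ℝ, 0 < η ∧ ENNReal.ofReal η ≤ ε := by
    obtain ⟨η, h1, h2⟩ := ENNReal.lt_iff_exists_real_btwn.1 hε
    exact ⟨η, ENNReal.ofReal_pos.1 h2.1, h2.2.le⟩
  -- This makes 128 / T = η / 2. T is fixed before n grows, so the term (m/n)(2T² + 8) still tends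
  -- to 0.
  set T : ℝ := 256 / η with hT
  have hT0 : 0 < T := by positivity
  have hmt' : Tendsto (fun n => (m n : ℝ)) atTop atTop := tendsto_natCast_atTop_atTop.comp hmt
  have hlim : Tendsto (fun n : ℕ => (2 * (m n : ℝ)) ^ 2 / ((2 * m n - 1) * (2 * m n - 2))
      + ((m n : ℝ) / n) * (2 * T ^ 2 + 8)) atTop (𝓝 1) := by
    have h1 : Tendsto (fun n => (m n : ℝ)⁻¹) atTop (𝓝 0) := tendsto_inv_atTop_zero.comp hmt'
    have h2 : Tendsto (fun n => 4 / ((2 - (m n : ℝ)⁻¹) * (2 - 2 * (m n : ℝ)⁻¹))) atTop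
        (𝓝 (4 / ((2 - 0) * (2 - 2 * 0)))) :=
      tendsto_const_nhds.div ((tendsto_const_nhds.sub h1).mul
        (tendsto_const_nhds.sub (h1.const_mul 2))) (by norm_num)
    have h3 : Tendsto (fun n : ℕ => (2 * (m n : ℝ)) ^ 2 / ((2 * m n - 1) * (2 * m n - 2))) atTop
        (𝓝 (4 / ((2 - 0) * (2 - 2 * 0)))) := by
      refine h2.congr' ?_
      filter_upwards [hmt.eventually_ge_atTop 2] with n hn
      have hm2 : (2 : ℝ) ≤ m n := by exact_mod_cast hn
      have hm0 : (0 : ℝ) < m n := by linarith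
      have d1 : (2 * (m n : ℝ) - 1) ≠ 0 := by linarith
      have d2 : (2 * (m n : ℝ) - 2) ≠ 0 := by linarith
      rw [show (2 - (m n : ℝ)⁻¹) = (2 * m n - 1) / m n by field_simp,
        show (2 - 2 * (m n : ℝ)⁻¹) = (2 * m n - 2) / m n by field_simp]
      field_simp
      norm_num
    convert h3.add (hmn.mul_const (2 * T ^ 2 + 8)) using 2
    norm_num
  have hev : ∀ᶠ n : ℕ in atTop, (m n : ℝ) / n < 1 / 2 := hmn.eventually_lt_const (by norm_num)
  filter_upwards [hlim.eventually_lt_const (show (1 : ℝ) < 1 + η / 2 by linarith), hev,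
    hmt.eventually_ge_atTop 6, eventually_gt_atTop 0] with n h1 h2 h3 h4
  have hn0 : (0 : ℝ) < n := by exact_mod_cast h4
  have hlt : 2 * m n < n := by
    rw [div_lt_iff₀ hn0] at h2
    have : 2 * (m n : ℝ) < n := by linarith
    exact_mod_cast this
  have h := lintegral_spacingDeviation_le hm hi hl h3 hlt hT0
  have hTη : 128 / T = η / 2 := by
    rw [hT]
    field_simp
    norm_num
  have h5 : ∫⁻ ω, ENNReal.ofReal (spacingDeviation μ (m n) fun j : Fin n => Y j ω) ∂P + 1
      ≤ ENNReal.ofReal η + 1 := by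
    refine h.trans ?_
    rw [← ENNReal.ofReal_one, ← ENNReal.ofReal_add hη0.le zero_le_one]
    apply ENNReal.ofReal_le_ofReal
    rw [hTη]
    linarith
  exact ((ENNReal.add_le_add_iff_right ENNReal.one_ne_top).1 h5).trans hηε

end iid

/-! ### Window averages of the density -/

/-- Truncation of a real number to `[-K, K]`. -/
noncomputable def truncate (K t : ℝ) : ℝ := max (-K) (min t K)

theorem truncate_mono (K : ℝ) : Monotone (truncate K) := fun _ _ h =>
  max_le_max le_rfl (min_le_min h le_rfl)

/-- Nearby points are handled by uniform continuity; distant ones are charged to the window width.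
Truncating the width keeps its telescoping total bounded however far the sample spreads. -/
theorem exists_oscillation_bound {g : ℝ → ℝ} (hg : Continuous g) (hc : HasCompactSupport g)
    {η : ℝ} (hη : 0 < η) : ∃ C K : ℝ, 0 ≤ C ∧ 0 ≤ K ∧ ∀ a b s t, a ≤ s → s ≤ b → a ≤ t → t ≤ b →
      |g s - g t| ≤ η + C * (truncate K b - truncate K a) := by
  obtain ⟨δ₀, hδ₀, hδ⟩ := Metric.uniformContinuous_iff.1 (hc.uniformContinuous_of_continuous hg) η hη
  obtain ⟨B, hB⟩ := hc.exists_bound_of_continuous hg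
  obtain ⟨K, hK⟩ := hc.isCompact.isBounded.subset_closedBall 0
  have hzero : ∀ t, max K 0 < |t| → g t = 0 := by
    intro t ht
    apply image_eq_zero_of_notMem_tsupport
    intro h
    have := hK h
    rw [mem_closedBall_zero_iff, Real.norm_eq_abs] at this
    linarith [le_max_left K 0]
  set K₀ := max K 0 with hK₀
  have hK0 : 0 ≤ K₀ := le_max_right _ _
  have hB0 : 0 ≤ B := (norm_nonneg _).trans (hB 0)
  set δ := min δ₀ 1 with hδdef
  have hδ0 : 0 < δ := lt_min hδ₀ one_pos
  have hδ1 : δ ≤ 1 := min_le_right _ _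
  have hlt : ∀ a b s t, a ≤ s → s ≤ t → t ≤ b →
      |g s - g t| ≤ η + 2 * B / δ * (truncate (K₀ + 1) b - truncate (K₀ + 1) a) := by
    intro a b s t has hst htb
    have htr : truncate (K₀ + 1) t - truncate (K₀ + 1) s
        ≤ truncate (K₀ + 1) b - truncate (K₀ + 1) a :=
      sub_le_sub (truncate_mono _ htb) (truncate_mono _ has)
    have htr0 : 0 ≤ truncate (K₀ + 1) t - truncate (K₀ + 1) s :=
      sub_nonneg.2 (truncate_mono _ hst)
    have hpos : 0 ≤ 2 * B / δ * (truncate (K₀ + 1) b - truncate (K₀ + 1) a) :=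
      mul_nonneg (by positivity) (htr0.trans htr)
    by_cases hclose : t - s < δ
    · have := hδ (a := s) (b := t) (by
        rw [dist_comm, Real.dist_eq, abs_of_nonneg (by linarith)]
        exact hclose.trans_le (min_le_left _ _))
      rw [Real.dist_eq] at this
      linarith
    · by_cases hout : K₀ < |s| ∧ K₀ < |t|
      · rw [hzero s hout.1, hzero t hout.2, sub_zero, abs_zero]
        linarith
      -- One point lies in [-K₀, K₀] and δ ≤ 1, so truncating at K₀ + 1 keeps a distance of at least
      -- δ.
      · have hgap : δ ≤ truncate (K₀ + 1) t - truncate (K₀ + 1) s := by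
          rw [not_and_or, not_lt, not_lt, abs_le, abs_le] at hout
          unfold truncate
          rcases hout with ⟨h1, h2⟩ | ⟨h1, h2⟩
          · rw [min_eq_left (by linarith : s ≤ K₀ + 1), max_eq_right (by linarith : -(K₀ + 1) ≤ s)]
            have : s + δ ≤ min t (K₀ + 1) := le_min (by linarith) (by linarith)
            linarith [le_max_right (-(K₀ + 1)) (min t (K₀ + 1))]
          · rw [min_eq_left (by linarith : t ≤ K₀ + 1), max_eq_right (by linarith : -(K₀ + 1) ≤ t)]
            have : max (-(K₀ + 1)) (min s (K₀ + 1)) ≤ t - δ :=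
              max_le (by linarith) ((min_le_left _ _).trans (by linarith))
            linarith
        have h2B : |g s - g t| ≤ 2 * B := by
          have h1 := hB s
          have h2 := hB t
          rw [Real.norm_eq_abs] at h1 h2
          linarith [abs_sub (g s) (g t)]
        have : 2 * B ≤ 2 * B / δ * (truncate (K₀ + 1) b - truncate (K₀ + 1) a) := by
          calc 2 * B = 2 * B / δ * δ := by field_simp
            _ ≤ _ := by
              gcongr
              exact hgap.trans htr
        linarith
  refine ⟨2 * B / δ, K₀ + 1, by positivity, by positivity, fun a b s t h1 h2 h3 h4 => ?_⟩
  rcases le_total s t with h | h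
  · exact hlt a b s t h1 h h4
  · rw [abs_sub_comm]
    exact hlt a b t s h3 h h2

theorem sum_window_truncate_le {K : ℝ} (hK : 0 ≤ K) (m : ℕ) {n : ℕ} (x : Fin n → ℝ) :
    ∑ i ∈ Finset.Icc 1 n, (truncate K (orderStat x ((i : ℤ) + m))
      - truncate K (orderStat x ((i : ℤ) - m))) ≤ 4 * m * K := by
  refine (sum_window_le (a := fun i => truncate K (orderStat x i)) (-K) K (fun _ => le_max_left _ _)
    (fun _ => max_le (by linarith) (min_le_right _ _)) m n).trans (le_of_eq ?_)
  ring

theorem sum_window_integral_le {φ : ℝ → ℝ} (hφ : Integrable φ) (h0 : ∀ t, 0 ≤ φ t) (m : ℕ) {n : ℕ}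
    (x : Fin n → ℝ) :
    ∑ i ∈ Finset.Icc 1 n, ∫ t in orderStat x ((i : ℤ) - m)..orderStat x ((i : ℤ) + m), φ t
      ≤ 2 * m * ∫ t, φ t := by
  have h := sum_window_le (a := fun i => ∫ t in Set.Iic (orderStat x i), φ t) 0 (∫ t, φ t)
    (fun _ => integral_nonneg h0)
    (fun _ => setIntegral_le_integral hφ (Eventually.of_forall h0)) m n
  rw [sub_zero] at h
  refine le_trans (le_of_eq (Finset.sum_congr rfl fun i _ => ?_)) h
  rw [intervalIntegral.integral_Iic_sub_Iic hφ.integrableOn hφ.integrableOn]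

theorem gapMass_densityLaw {f : ℝ → ℝ} (hf : Measurable f) (h0 : ∀ t, 0 ≤ f t) {a b : ℝ}
    (hab : a ≤ b) : gapMass (densityLaw f) (a, b) = ∫ t in a..b, f t := by
  unfold gapMass densityLaw
  rw [Measure.real, withDensity_apply _ measurableSet_Ioo, intervalIntegral.integral_of_le hab,
    integral_Ioc_eq_integral_Ioo, integral_eq_lintegral_of_nonneg_ae (Eventually.of_forall h0)
      hf.aestronglyMeasurable]

/-- The average of `f` over the interval `[a, b]`. -/
noncomputable def windowAvg (f : ℝ → ℝ) (a b : ℝ) : ℝ := (b - a)⁻¹ * ∫ t in a..b, f t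

theorem windowAvg_nonneg {f : ℝ → ℝ} (h0 : ∀ t, 0 ≤ f t) {a b : ℝ} (hab : a < b) :
    0 ≤ windowAvg f a b :=
  mul_nonneg (inv_nonneg.2 (sub_nonneg.2 hab.le))
    (intervalIntegral.integral_nonneg hab.le fun t _ => h0 t)

theorem integral_le_mul_sub {f : ℝ → ℝ} (hf : Integrable f) {M : ℝ} (hM : ∀ t, f t ≤ M) {a b : ℝ}
    (hab : a ≤ b) : ∫ t in a..b, f t ≤ M * (b - a) := by
  have := intervalIntegral.integral_mono_on (g := fun _ => M) hab hf.intervalIntegrable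
    intervalIntegrable_const fun t _ => hM t
  rwa [intervalIntegral.integral_const, smul_eq_mul, mul_comm] at this

theorem windowAvg_le {f : ℝ → ℝ} (hf : Integrable f) {M : ℝ} (hM : ∀ t, f t ≤ M) {a b : ℝ}
    (hab : a < b) : windowAvg f a b ≤ M := by
  unfold windowAvg
  rw [inv_mul_le_iff₀ (sub_pos.2 hab), mul_comm]
  exact integral_le_mul_sub hf hM hab.le

theorem abs_windowAvg_sub_le {f g : ℝ → ℝ} (hf : Integrable f) (hg : Integrable g) {a b u κ : ℝ}
    (hab : a < b) (hκ : ∀ t, a ≤ t → t ≤ b → |g t - g u| ≤ κ) :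
    |windowAvg f a b - f u| ≤ windowAvg (fun t => |f t - g t|) a b + κ + |f u - g u| := by
  have hpos : 0 < b - a := sub_pos.2 hab
  have e1 : windowAvg f a b - f u = (b - a)⁻¹ * ∫ t in a..b, (f t - f u) := by
    unfold windowAvg
    rw [intervalIntegral.integral_sub hf.intervalIntegrable intervalIntegrable_const,
      intervalIntegral.integral_const, smul_eq_mul]
    field_simp
  have hφ : IntervalIntegrable (fun t => |f t - g t|) volume a b :=
    (hf.sub hg).abs.intervalIntegrable
  have e2 : |∫ t in a..b, (f t - f u)| ≤ ∫ t in a..b, (|f t - g t| + (κ + |f u - g u|)) := by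
    refine (intervalIntegral.abs_integral_le_integral_abs hab.le).trans ?_
    refine intervalIntegral.integral_mono_on hab.le
      (hf.intervalIntegrable.sub intervalIntegrable_const).abs
      (hφ.add intervalIntegrable_const) fun t ht => ?_
    have h1 := hκ t ht.1 ht.2
    calc |f t - f u| = |(f t - g t) + (g t - g u) + (g u - f u)| := by ring_nf
      _ ≤ |f t - g t| + |g t - g u| + |g u - f u| := abs_add_three _ _ _
      _ ≤ _ := by rw [abs_sub_comm (g u)]; linarith
  rw [intervalIntegral.integral_add hφ intervalIntegrable_const, intervalIntegral.integral_const,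
    smul_eq_mul] at e2
  rw [e1, abs_mul, abs_of_pos (inv_pos.2 hpos)]
  calc _ ≤ (b - a)⁻¹ * ((∫ t in a..b, |f t - g t|) + (b - a) * (κ + |f u - g u|)) := by gcongr
    _ = _ := by
      unfold windowAvg
      field_simp
      ring

theorem GenericSample.window_lt {μ : Measure ℝ} {n m : ℕ} {x : Fin n → ℝ}
    (hx : GenericSample μ x) (hm : 1 ≤ m) (hmn : 2 * m < n) {i : ℕ} (h1 : 1 ≤ i) (hn : i ≤ n) :
    orderStat x ((i : ℤ) - m) < orderStat x ((i : ℤ) + m) :=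
  orderStat_lt hx.injective (by omega) (by omega) (by omega) (by omega)

theorem spacingRatio_eq {f : ℝ → ℝ} (hf : Measurable f) (h0 : ∀ t, 0 ≤ f t) {n m : ℕ}
    {x : Fin n → ℝ} (hx : GenericSample (densityLaw f) x) (hm : 2 ≤ m) (hmn : 2 * m < n) {i : ℕ}
    (h1 : 1 ≤ i) (hn : i ≤ n) :
    spacingRatio m x i = normSpacing (densityLaw f) m x i
      * windowAvg f (orderStat x ((i : ℤ) - m)) (orderStat x ((i : ℤ) + m)) := by
  have hlt := hx.window_lt (by omega) hmn h1 hn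
  have hpos := hx.window_pos hm hmn h1 hn
  unfold spacingRatio normSpacing windowAvg
  rw [← gapMass_densityLaw hf h0 hlt.le]
  have : orderStat x ((i : ℤ) + m) - orderStat x ((i : ℤ) - m) ≠ 0 := (sub_pos.2 hlt).ne'
  field_simp

/-- If Y ≤ 2 the window has mass at least m/(2n), hence width at least m/(2Mn) because f ≤ M. If Y >
2, then (Y - 1)² > 1 and the trivial bound B is charged to the deviation. -/
theorem windowAvg_le_add {f φ : ℝ → ℝ} (hf : Measurable f) (h0 : ∀ t, 0 ≤ f t)
    (hfi : Integrable f) {M B : ℝ} (hM : 0 < M) (hfM : ∀ t, f t ≤ M) (hφi : Integrable φ)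
    (hφ0 : ∀ t, 0 ≤ φ t) (hφB : ∀ t, φ t ≤ B) {n m : ℕ} {x : Fin n → ℝ}
    (hx : GenericSample (densityLaw f) x) (hm : 2 ≤ m) (hmn : 2 * m < n) {i : ℕ}
    (h1 : 1 ≤ i) (hn : i ≤ n) :
    windowAvg φ (orderStat x ((i : ℤ) - m)) (orderStat x ((i : ℤ) + m))
      ≤ 2 * M * n / m * (∫ t in orderStat x ((i : ℤ) - m)..orderStat x ((i : ℤ) + m), φ t)
        + B * (normSpacing (densityLaw f) m x i - 1) ^ 2 := by
  have hlt := hx.window_lt (by omega) hmn h1 hn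
  have hpos := hx.window_pos hm hmn h1 hn
  have hB : 0 ≤ B := (hφ0 0).trans (hφB 0)
  have hm0 : (0 : ℝ) < m := by exact_mod_cast (by omega : 0 < m)
  have hn0 : (0 : ℝ) < n := by exact_mod_cast (by omega : 0 < n)
  have hw := one_le_spacingWeight (m := m) h1 hn
  have hY : normSpacing (densityLaw f) m x i = spacingWeight m n i * ((m : ℝ) / n) /
    gapMass (densityLaw f) (orderStat x ((i : ℤ) - m), orderStat x ((i : ℤ) + m)) := rfl
  have hH : gapMass (densityLaw f) (orderStat x ((i : ℤ) - m), orderStat x ((i : ℤ) + m))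
      ≤ M * (orderStat x ((i : ℤ) + m) - orderStat x ((i : ℤ) - m)) := by
    rw [gapMass_densityLaw hf h0 hlt.le]
    exact integral_le_mul_sub hfi hfM hlt.le
  have hI : 0 ≤ ∫ t in orderStat x ((i : ℤ) - m)..orderStat x ((i : ℤ) + m), φ t :=
    intervalIntegral.integral_nonneg hlt.le fun t _ => hφ0 t
  set a := orderStat x ((i : ℤ) - m)
  set b := orderStat x ((i : ℤ) + m)
  set Y := normSpacing (densityLaw f) m x i
  set H := gapMass (densityLaw f) (a, b)
  have hba : 0 < b - a := sub_pos.2 hlt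
  by_cases h2 : Y ≤ 2
  · have hinv : (b - a)⁻¹ ≤ 2 * M * n / m := by
      rw [hY, div_le_iff₀ hpos] at h2
      have h3 : (m : ℝ) / n ≤ 2 * (M * (b - a)) :=
        calc (m : ℝ) / n ≤ spacingWeight m n i * ((m : ℝ) / n) :=
              le_mul_of_one_le_left (by positivity) hw
          _ ≤ 2 * H := h2
          _ ≤ _ := by linarith
      rw [inv_le_iff_one_le_mul₀ hba, div_mul_eq_mul_div, le_div_iff₀ hm0]
      rw [div_le_iff₀ hn0] at h3
      linarith
    have hsq : 0 ≤ B * (Y - 1) ^ 2 := by positivity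
    have : windowAvg φ a b ≤ 2 * M * n / m * ∫ t in a..b, φ t := by
      unfold windowAvg
      gcongr
    linarith
  · have h3 : windowAvg φ a b ≤ B := windowAvg_le hφi hφB hlt
    have h4 : B ≤ B * (Y - 1) ^ 2 := by
      apply le_mul_of_one_le_right hB
      have : 2 < Y := not_le.1 h2
      nlinarith
    have h5 : 0 ≤ 2 * M * n / m * ∫ t in a..b, φ t := by positivity
    linarith

/-- The mean absolute difference between the window averages of `f` and the values of `f` at the
sample points. -/
noncomputable def windowError (f : ℝ → ℝ) (m : ℕ) {n : ℕ} (x : Fin n → ℝ) : ℝ :=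
  (1 / (n : ℝ)) * ∑ i ∈ Finset.Icc 1 n,
    |windowAvg f (orderStat x ((i : ℤ) - m)) (orderStat x ((i : ℤ) + m)) - f (orderStat x (i : ℤ))|

theorem windowError_le {f g : ℝ → ℝ} (hf : Measurable f) (h0 : ∀ t, 0 ≤ f t)
    (hfi : Integrable f) {M B η C K : ℝ} (hM : 0 < M) (hfM : ∀ t, f t ≤ M) (hgi : Integrable g)
    (hB : ∀ t, |f t - g t| ≤ B) (hC : 0 ≤ C) (hK : 0 ≤ K)
    (hosc : ∀ a b s t, a ≤ s → s ≤ b → a ≤ t → t ≤ b →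
      |g s - g t| ≤ η + C * (truncate K b - truncate K a))
    {n m : ℕ} {x : Fin n → ℝ}
    (hx : GenericSample (densityLaw f) x) (hm : 2 ≤ m) (hmn : 2 * m < n) :
    windowError f m x ≤ 4 * M * (∫ t, |f t - g t|) + B * spacingDeviation (densityLaw f) m x
      + η + 4 * C * K * ((m : ℝ) / n) + (∑ j, |f (x j) - g (x j)|) / n := by
  have hm0 : (0 : ℝ) < m := by exact_mod_cast (by omega : 0 < m)
  have hn0 : (0 : ℝ) < n := by exact_mod_cast (by omega : 0 < n)
  have hφi : Integrable fun t => |f t - g t| := (hfi.sub hgi).abs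
  have hterm : ∀ i ∈ Finset.Icc 1 n,
      |windowAvg f (orderStat x ((i : ℤ) - m)) (orderStat x ((i : ℤ) + m))
        - f (orderStat x (i : ℤ))|
      ≤ 2 * M * n / m *
          (∫ t in orderStat x ((i : ℤ) - m)..orderStat x ((i : ℤ) + m), |f t - g t|)
        + B * (normSpacing (densityLaw f) m x i - 1) ^ 2
        + (η + C * (truncate K (orderStat x ((i : ℤ) + m))
          - truncate K (orderStat x ((i : ℤ) - m))))
        + |f (orderStat x (i : ℤ)) - g (orderStat x (i : ℤ))| := by
    intro i hi
    rw [Finset.mem_Icc] at hi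
    have hlt := hx.window_lt (by omega) hmn hi.1 hi.2
    have hau : orderStat x ((i : ℤ) - m) ≤ orderStat x (i : ℤ) := orderStat_monotone x (by omega)
    have hub : orderStat x (i : ℤ) ≤ orderStat x ((i : ℤ) + m) := orderStat_monotone x (by omega)
    have e1 := abs_windowAvg_sub_le hfi hgi hlt fun t h1 h2 => hosc _ _ t _ h1 h2 hau hub
    have e2 := windowAvg_le_add hf h0 hfi hM hfM hφi (fun t => abs_nonneg _) hB hx hm hmn hi.1 hi.2
    linarith
  have hsum := Finset.sum_le_sum hterm
  rw [Finset.sum_add_distrib, Finset.sum_add_distrib, Finset.sum_add_distrib,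
    Finset.sum_add_distrib, ← Finset.mul_sum, ← Finset.mul_sum, ← Finset.mul_sum, Finset.sum_const,
    nsmul_eq_mul, Nat.card_Icc, Nat.add_sub_cancel,
    sum_orderStat x fun t => |f t - g t|] at hsum
  have s1 := sum_window_integral_le hφi (fun t => abs_nonneg _) m x
  have s2 := sum_window_truncate_le hK m x
  -- The overlap factor 2m of the windows cancels the m in the denominator, leaving an L¹ error with
  -- a constant independent of m.
  have s1' : 2 * M * n / m * (∑ i ∈ Finset.Icc 1 n,
      ∫ t in orderStat x ((i : ℤ) - m)..orderStat x ((i : ℤ) + m), |f t - g t|)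
      ≤ n * (4 * M * ∫ t, |f t - g t|) :=
    calc _ ≤ 2 * M * n / m * (2 * m * ∫ t, |f t - g t|) := by gcongr
      _ = _ := by
        field_simp
        ring
  have s2' := mul_le_mul_of_nonneg_left s2 hC
  unfold windowError spacingDeviation
  rw [one_div, inv_mul_le_iff₀ hn0]
  refine hsum.trans ?_
  refine (add_le_add (add_le_add (add_le_add s1' le_rfl) (add_le_add le_rfl s2')) le_rfl).trans
    (le_of_eq ?_)
  field_simp
  ring

/-- Purely deterministic: the sample path is fixed, and the filter is arbitrary so that a
subsequence can be inserted. -/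
theorem tendsto_windowError {f : ℝ → ℝ} (hf : Measurable f) (h0 : ∀ t, 0 ≤ f t)
    (hfi : Integrable f) {M : ℝ} (hM : 0 < M) (hfM : ∀ t, f t ≤ M) {x : ℕ → ℝ}
    (hx : ∀ n : ℕ, GenericSample (densityLaw f) fun j : Fin n => x j) {m : ℕ → ℕ} {l : Filter ℕ}
    (hm : ∀ᶠ n in l, 2 ≤ m n ∧ 2 * m n < n) (hmn : Tendsto (fun n => (m n : ℝ) / n) l (𝓝 0))
    (hD : Tendsto (fun n => spacingDeviation (densityLaw f) (m n) fun j : Fin n => x j) l (𝓝 0))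
    (happ : ∀ ε > 0, ∃ g : ℝ → ℝ, Continuous g ∧ HasCompactSupport g ∧ (∫ t, |f t - g t|) ≤ ε ∧
      ∀ᶠ n : ℕ in l, (∑ j : Fin n, |f (x j) - g (x j)|) / n ≤ ε) :
    Tendsto (fun n => windowError f (m n) fun j : Fin n => x j) l (𝓝 0) := by
  have hnn : ∀ n, 0 ≤ windowError f (m n) fun j : Fin n => x j := fun n =>
    mul_nonneg (by positivity) (Finset.sum_nonneg fun _ _ => abs_nonneg _)
  rw [Metric.tendsto_nhds]
  intro ε hε
  -- The L¹ error costs 4M shares; the oscillation, the sample mean of |f - g|, and the vanishing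
  -- terms cost one each.
  set ε' := ε / (4 * M + 3) with hε'
  have hε'0 : 0 < ε' := by positivity
  obtain ⟨g, hg, hgc, hgε, hgx⟩ := happ ε' hε'0
  obtain ⟨Bg, hBg⟩ := hgc.exists_bound_of_continuous hg
  obtain ⟨C, K, hC, hK, hosc⟩ := exists_oscillation_bound hg hgc hε'0
  have hB : ∀ t, |f t - g t| ≤ M + Bg := fun t => by
    have h1 := hBg t
    have h2 := abs_sub (f t) (g t)
    rw [abs_of_nonneg (h0 t)] at h2
    rw [Real.norm_eq_abs] at h1
    linarith [hfM t]
  have hlim : Tendsto (fun n => (M + Bg) * spacingDeviation (densityLaw f) (m n)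
      (fun j : Fin n => x j) + 4 * C * K * ((m n : ℝ) / n)) l (𝓝 0) := by
    simpa using (hD.const_mul (M + Bg)).add (hmn.const_mul (4 * C * K))
  filter_upwards [hm, hgx, hlim.eventually_lt_const hε'0] with n h1 h2 h3
  rw [Real.dist_eq, sub_zero, abs_of_nonneg (hnn n)]
  have h := windowError_le hf h0 hfi hM hfM (hg.integrable_of_hasCompactSupport hgc) hB hC hK hosc
    (hx n) h1.1 h1.2
  have h4 : 4 * M * (∫ t, |f t - g t|) ≤ 4 * M * ε' := by gcongr
  have h5 : (4 * M + 3) * ε' = ε := by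
    rw [hε']
    field_simp
  linarith

/-! ### Combining the spacing and window errors into the estimator -/

theorem abs_mul_sub_le {y G u M : ℝ} (hG0 : 0 ≤ G) (hGM : G ≤ M) :
    |y * G - u| ≤ M * |y - 1| + |G - u| := by
  calc |y * G - u| = |(y - 1) * G + (G - u)| := by ring_nf
    _ ≤ |(y - 1) * G| + |G - u| := abs_add_le _ _
    _ ≤ _ := by
      rw [abs_mul, abs_of_nonneg hG0, mul_comm M]
      gcongr

/-- As y is unbounded, its error enters quadratically; since |G - u| ≤ M, the square of the other
error becomes linear and a mean absolute window error suffices. -/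
theorem abs_sq_mul_sub_sq_le {y G u M : ℝ} (hG0 : 0 ≤ G) (hGM : G ≤ M) (hu0 : 0 ≤ u)
    (huM : u ≤ M) : |(y * G) ^ 2 - u ^ 2|
      ≤ 2 * M ^ 2 * (y - 1) ^ 2 + 2 * M ^ 2 * |y - 1| + 4 * M * |G - u| := by
  have hM0 : 0 ≤ M := hu0.trans huM
  have h1 := abs_mul_sub_le (y := y) (u := u) hG0 hGM
  have hGu : |G - u| ≤ M := by
    rw [abs_le]
    constructor <;> linarith
  have h2 : |y * G - u| ^ 2 ≤ 2 * M ^ 2 * (y - 1) ^ 2 + 2 * M * |G - u| := by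
    calc _ ≤ (M * |y - 1| + |G - u|) ^ 2 := by gcongr
      _ ≤ 2 * (M * |y - 1|) ^ 2 + 2 * |G - u| ^ 2 := by
        nlinarith [sq_nonneg (M * |y - 1| - |G - u|)]
      _ ≤ 2 * (M * |y - 1|) ^ 2 + 2 * (M * |G - u|) := by
        have : |G - u| ^ 2 ≤ M * |G - u| := by
          rw [sq]
          gcongr
        linarith
      _ = _ := by
        rw [mul_pow, sq_abs]
        ring
  calc |(y * G) ^ 2 - u ^ 2| = |(y * G - u) ^ 2 + 2 * u * (y * G - u)| := by ring_nf
    _ ≤ |(y * G - u) ^ 2| + |2 * u * (y * G - u)| := abs_add_le _ _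
    _ = |y * G - u| ^ 2 + 2 * u * |y * G - u| := by
      rw [abs_pow, abs_mul, abs_of_nonneg (by positivity : 0 ≤ 2 * u)]
    _ ≤ (2 * M ^ 2 * (y - 1) ^ 2 + 2 * M * |G - u|) + 2 * M * (M * |y - 1| + |G - u|) := by
      gcongr
    _ = _ := by ring

/-- The mean absolute deviation of the normalised spacings from `1`. -/
noncomputable def spacingAbsDeviation (μ : Measure ℝ) (m : ℕ) {n : ℕ} (x : Fin n → ℝ) : ℝ :=
  (1 / (n : ℝ)) * ∑ i ∈ Finset.Icc 1 n, |normSpacing μ m x i - 1|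

theorem spacingAbsDeviation_sq_le (μ : Measure ℝ) (m : ℕ) {n : ℕ} (x : Fin n → ℝ) :
    spacingAbsDeviation μ m x ^ 2 ≤ spacingDeviation μ m x := by
  unfold spacingAbsDeviation spacingDeviation
  rcases Nat.eq_zero_or_pos n with rfl | hn
  · simp
  have hn0 : (0 : ℝ) < n := by exact_mod_cast hn
  have h := sq_sum_le_card_mul_sum_sq (s := Finset.Icc 1 n) (f := fun i => |normSpacing μ m x i - 1|)
  simp only [sq_abs, Nat.card_Icc, Nat.add_sub_cancel] at h
  rw [mul_pow]
  calc _ ≤ (1 / (n : ℝ)) ^ 2 * (n * ∑ i ∈ Finset.Icc 1 n, (normSpacing μ m x i - 1) ^ 2) := by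
        gcongr
    _ = _ := by field_simp

theorem abs_mean_sub_le {n : ℕ} {u v w : ℕ → ℝ} (h : ∀ i ∈ Finset.Icc 1 n, |u i - v i| ≤ w i) :
    |(1 / (n : ℝ)) * ∑ i ∈ Finset.Icc 1 n, u i - (1 / (n : ℝ)) * ∑ i ∈ Finset.Icc 1 n, v i|
      ≤ (1 / (n : ℝ)) * ∑ i ∈ Finset.Icc 1 n, w i := by
  rw [← mul_sub, ← Finset.sum_sub_distrib, abs_mul, abs_of_nonneg (by positivity : 0 ≤ 1 / (n : ℝ))]
  gcongr
  exact (Finset.abs_sum_le_sum_abs _ _).trans (Finset.sum_le_sum h)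

theorem tendsto_VJQ {f : ℝ → ℝ} (hf : Measurable f) (h0 : ∀ t, 0 ≤ f t)
    (hfi : Integrable f) {M : ℝ} (hfM : ∀ t, f t ≤ M) {x : ℕ → ℝ}
    (hx : ∀ n : ℕ, GenericSample (densityLaw f) fun j : Fin n => x j) {m : ℕ → ℕ} {l : Filter ℕ}
    (hm : ∀ᶠ n in l, 2 ≤ m n ∧ 2 * m n < n)
    (hD : Tendsto (fun n => spacingDeviation (densityLaw f) (m n) fun j : Fin n => x j) l (𝓝 0))
    (hE : Tendsto (fun n => windowError f (m n) fun j : Fin n => x j) l (𝓝 0)) {A₁ A₂ : ℝ}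
    (hA₁ : Tendsto (fun n : ℕ => (∑ j : Fin n, f (x j)) / n) l (𝓝 A₁))
    (hA₂ : Tendsto (fun n : ℕ => (∑ j : Fin n, f (x j) ^ 2) / n) l (𝓝 A₂)) :
    Tendsto (fun n => VJQ (m n) fun j : Fin n => x j) l (𝓝 (1 / 4 * (A₂ - A₁ ^ 2))) := by
  have hAbs : Tendsto (fun n => spacingAbsDeviation (densityLaw f) (m n) fun j : Fin n => x j) l
      (𝓝 0) := by
    have hs : Tendsto (fun n => √(spacingDeviation (densityLaw f) (m n) fun j : Fin n => x j)) l
        (𝓝 0) := by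
      simpa [Function.comp_def] using (Real.continuous_sqrt.tendsto 0).comp hD
    refine squeeze_zero (fun n => ?_) (fun n => ?_) hs
    · exact mul_nonneg (by positivity) (Finset.sum_nonneg fun _ _ => abs_nonneg _)
    · exact Real.le_sqrt_of_sq_le (spacingAbsDeviation_sq_le _ _ _)
  have hterm : ∀ n : ℕ, (2 ≤ m n ∧ 2 * m n < n) → ∀ i ∈ Finset.Icc 1 n,
      |spacingRatio (m n) (fun j : Fin n => x j) i - f (orderStat (fun j : Fin n => x j) i)|
        ≤ M * |normSpacing (densityLaw f) (m n) (fun j : Fin n => x j) i - 1|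
          + |windowAvg f (orderStat (fun j : Fin n => x j) ((i : ℤ) - m n))
              (orderStat (fun j : Fin n => x j) ((i : ℤ) + m n))
            - f (orderStat (fun j : Fin n => x j) i)| ∧
      |spacingRatio (m n) (fun j : Fin n => x j) i ^ 2
          - f (orderStat (fun j : Fin n => x j) i) ^ 2|
        ≤ 2 * M ^ 2 * (normSpacing (densityLaw f) (m n) (fun j : Fin n => x j) i - 1) ^ 2
          + 2 * M ^ 2 * |normSpacing (densityLaw f) (m n) (fun j : Fin n => x j) i - 1|
          + 4 * M * |windowAvg f (orderStat (fun j : Fin n => x j) ((i : ℤ) - m n))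
              (orderStat (fun j : Fin n => x j) ((i : ℤ) + m n))
            - f (orderStat (fun j : Fin n => x j) i)| := by
    intro n hn i hi
    rw [Finset.mem_Icc] at hi
    have hlt := (hx n).window_lt (by omega) hn.2 hi.1 hi.2
    rw [spacingRatio_eq hf h0 (hx n) hn.1 hn.2 hi.1 hi.2]
    have hG0 := windowAvg_nonneg h0 hlt
    have hGM := windowAvg_le hfi hfM hlt
    exact ⟨abs_mul_sub_le hG0 hGM, abs_sq_mul_sub_sq_le hG0 hGM (h0 _) (hfM _)⟩
  have hR₁ : Tendsto (fun n : ℕ => (1 / (n : ℝ)) * ∑ i ∈ Finset.Icc 1 n,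
      spacingRatio (m n) (fun j : Fin n => x j) i) l (𝓝 A₁) := by
    have h0 : Tendsto (fun n => M * spacingAbsDeviation (densityLaw f) (m n)
        (fun j : Fin n => x j) + windowError f (m n) fun j : Fin n => x j) l (𝓝 0) := by
      simpa using (hAbs.const_mul M).add hE
    refine hA₁.congr_dist (squeeze_zero' (Eventually.of_forall fun _ => dist_nonneg) ?_ h0)
    filter_upwards [hm] with n hn
    have h := abs_mean_sub_le fun i hi => (hterm n hn i hi).1
    rw [sum_orderStat (fun j : Fin n => x j) f, Finset.sum_add_distrib, ← Finset.mul_sum] at h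
    rw [dist_comm, Real.dist_eq, div_eq_inv_mul (Finset.sum _ _), ← one_div]
    refine h.trans (le_of_eq ?_)
    unfold spacingAbsDeviation windowError
    ring
  have hR₂ : Tendsto (fun n : ℕ => (1 / (n : ℝ)) * ∑ i ∈ Finset.Icc 1 n,
      spacingRatio (m n) (fun j : Fin n => x j) i ^ 2) l (𝓝 A₂) := by
    have h0 : Tendsto (fun n => 2 * M ^ 2 * spacingDeviation (densityLaw f) (m n)
        (fun j : Fin n => x j) + 2 * M ^ 2 * spacingAbsDeviation (densityLaw f) (m n)
        (fun j : Fin n => x j) + 4 * M * windowError f (m n) fun j : Fin n => x j) l (𝓝 0) := by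
      have h := ((hD.const_mul (2 * M ^ 2)).add (hAbs.const_mul (2 * M ^ 2))).add
        (hE.const_mul (4 * M))
      simpa using h
    refine hA₂.congr_dist (squeeze_zero' (Eventually.of_forall fun _ => dist_nonneg) ?_ h0)
    filter_upwards [hm] with n hn
    have h := abs_mean_sub_le fun i hi => (hterm n hn i hi).2
    rw [sum_orderStat (fun j : Fin n => x j) fun t => f t ^ 2, Finset.sum_add_distrib,
      Finset.sum_add_distrib, ← Finset.mul_sum, ← Finset.mul_sum, ← Finset.mul_sum] at h
    rw [dist_comm, Real.dist_eq, div_eq_inv_mul (Finset.sum _ _), ← one_div]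
    refine h.trans (le_of_eq ?_)
    unfold spacingAbsDeviation windowError spacingDeviation
    ring
  exact (hR₂.sub (hR₁.pow 2)).const_mul (1 / 4)

theorem measurable_VJQ (m n : ℕ) : Measurable fun x : Fin n → ℝ => VJQ m x := by
  have h : ∀ i, Measurable fun x : Fin n → ℝ => spacingRatio m x i := fun i =>
    ((measurable_orderStat n _).sub (measurable_orderStat n _)).const_div _
  unfold VJQ
  exact (((Finset.measurable_sum _ fun i _ => (h i).pow_const 2).const_mul _).sub
    (((Finset.measurable_sum _ fun i _ => h i).const_mul _).pow_const 2)).const_mul _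

/-! ### Convergence in probability -/

theorem ae_tendsto_mean {Ω : Type*} [MeasurableSpace Ω] {P : Measure Ω} [IsProbabilityMeasure P]
    {μ : Measure ℝ} {X : ℕ → Ω → ℝ} (hm : ∀ i, Measurable (X i)) (hi : iIndepFun X P)
    (hl : ∀ i, P.map (X i) = μ) {φ : ℝ → ℝ} (hφ : Measurable φ) {B : ℝ} (hB : ∀ t, |φ t| ≤ B) :
    ∀ᵐ ω ∂P, Tendsto (fun n : ℕ => (∑ j : Fin n, φ (X j ω)) / n) atTop (𝓝 (∫ t, φ t ∂μ)) := by
  have h := strong_law_ae_real (fun i ω => φ (X i ω))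
    (Integrable.of_bound (hφ.comp (hm 0)).aestronglyMeasurable B (Eventually.of_forall fun ω => hB _))
    (fun i j hij => (hi.indepFun hij).comp hφ hφ)
    (fun i => (IdentDistrib.mk (hm i).aemeasurable (hm 0).aemeasurable
      (by rw [hl, hl])).comp hφ)
  rw [← hl 0, integral_map (hm 0).aemeasurable hφ.aestronglyMeasurable]
  filter_upwards [h] with ω hω
  refine hω.congr fun n => ?_
  rw [Finset.sum_range]

theorem integral_densityLaw {f : ℝ → ℝ} (hf : Measurable f) (h0 : ∀ t, 0 ≤ f t) (φ : ℝ → ℝ) :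
    ∫ t, φ t ∂densityLaw f = ∫ t, f t * φ t := by
  unfold densityLaw
  rw [integral_withDensity_eq_integral_toReal_smul hf.ennreal_ofReal
    (Eventually.of_forall fun _ => ENNReal.ofReal_lt_top)]
  refine integral_congr_ae (Eventually.of_forall fun t => ?_)
  simp [ENNReal.toReal_ofReal (h0 t)]

theorem integral_densityLaw_le {f φ : ℝ → ℝ} (hf : Measurable f) (h0 : ∀ t, 0 ≤ f t) {M : ℝ}
    (hM : ∀ t, f t ≤ M) (hφ : Integrable φ) (hφ0 : ∀ t, 0 ≤ φ t) :
    ∫ t, φ t ∂densityLaw f ≤ M * ∫ t, φ t := by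
  rw [integral_densityLaw hf h0, ← integral_const_mul]
  refine integral_mono_of_nonneg (Eventually.of_forall fun t => mul_nonneg (h0 t) (hφ0 t))
    (hφ.const_mul M) (Eventually.of_forall fun t => ?_)
  exact mul_le_mul_of_nonneg_right (hM t) (hφ0 t)

theorem integrable_of_densityLaw {f : ℝ → ℝ} (hf : Measurable f) (h0 : ∀ t, 0 ≤ f t)
    [IsFiniteMeasure (densityLaw f)] : Integrable f := by
  refine ⟨hf.aestronglyMeasurable, ?_⟩
  rw [hasFiniteIntegral_iff_ofReal (Eventually.of_forall h0)]
  have h := measure_lt_top (densityLaw f) Set.univ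
  rwa [densityLaw, withDensity_apply _ MeasurableSet.univ, Measure.restrict_univ] at h

theorem nullSingletonClass_densityLaw (f : ℝ → ℝ) : NullSingletonClass (densityLaw f) :=
  ⟨fun x => withDensity_absolutelyContinuous _ _ (measure_singleton x)⟩

theorem varextropy_eq {f : ℝ → ℝ} (hf : Measurable f) (h0 : ∀ t, 0 ≤ f t) {M : ℝ}
    (hM : ∀ t, f t ≤ M) [IsProbabilityMeasure (densityLaw f)] :
    varextropy f
      = 1 / 4 * (∫ t, f t ^ 2 ∂densityLaw f - (∫ t, f t ∂densityLaw f) ^ 2) := by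
  have hL : MemLp f 2 (densityLaw f) := MemLp.of_bound hf.aestronglyMeasurable M
    (Eventually.of_forall fun t => by rw [Real.norm_eq_abs, abs_of_nonneg (h0 t)]; exact hM t)
  unfold varextropy
  rw [variance_const_mul, variance_eq_sub hL]
  norm_num

theorem theorem2p5 {Ω : Type*} [MeasurableSpace Ω] (P : Measure Ω) [IsProbabilityMeasure P]
    (f : ℝ → ℝ) (hf_meas : Measurable f) (hf_nonneg : ∀ x, 0 ≤ f x)
    (hf_bdd : ∃ M : ℝ, ∀ x, f x ≤ M)
    (X : ℕ → Ω → ℝ) (hX_meas : ∀ i, Measurable (X i))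
    (hX_indep : iIndepFun X P)
    (hX_law : ∀ i, P.map (X i) = densityLaw f)
    (hX_var : ∀ i, MemLp (X i) 2 P)
    (m : ℕ → ℕ) (hm : Tendsto m atTop atTop)
    (hmn : Tendsto (fun n : ℕ => (m n : ℝ) / (n : ℝ)) atTop (𝓝 0)) :
    TendstoInMeasure P
      (fun (n : ℕ) (ω : Ω) => VJQ (m n) (fun j : Fin n => X j ω))
      atTop
      (fun _ => varextropy f) := by
  obtain ⟨M', hM'⟩ := hf_bdd
  set M := max M' 1 with hMdef
  have hM0 : 0 < M := lt_max_of_lt_right one_pos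
  have hfM : ∀ t, f t ≤ M := fun t => (hM' t).trans (le_max_left _ _)
  have hprob : IsProbabilityMeasure (densityLaw f) := by
    rw [← hX_law 0]
    exact Measure.isProbabilityMeasure_map (hX_meas 0).aemeasurable
  have hnull := nullSingletonClass_densityLaw f
  have hfi : Integrable f := integrable_of_densityLaw hf_meas hf_nonneg
  have habs : ∀ t, |f t| ≤ M := fun t => by
    rw [abs_of_nonneg (hf_nonneg t)]
    exact hfM t
  -- A countable family of approximants, so one null set serves the law of large numbers for all of
  -- them.
  have happrox : ∀ k : ℕ, ∃ g : ℝ → ℝ, HasCompactSupport g ∧ (∫ t, |f t - g t|) ≤ 1 / ((k : ℝ) + 1) ∧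
      Continuous g ∧ Integrable g := fun k =>
    hfi.exists_hasCompactSupport_integral_sub_le (by positivity)
  choose g hgc hgε hg hgi using happrox
  have hlln : ∀ᵐ ω ∂P, ∀ k, Tendsto (fun n : ℕ => (∑ j : Fin n, |f (X j ω) - g k (X j ω)|) / n)
      atTop (𝓝 (∫ t, |f t - g k t| ∂densityLaw f)) := by
    rw [ae_all_iff]
    intro k
    obtain ⟨B, hB⟩ := (hgc k).exists_bound_of_continuous (hg k)
    refine ae_tendsto_mean hX_meas hX_indep hX_law (φ := fun t => |f t - g k t|)
      (hf_meas.sub (hg k).measurable).abs (B := M + B) fun t => ?_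
    have h := hB t
    rw [Real.norm_eq_abs] at h
    rw [abs_abs]
    exact (abs_sub _ _).trans (add_le_add (habs t) h)
  have hlln₁ := ae_tendsto_mean hX_meas hX_indep hX_law hf_meas habs
  have hlln₂ := ae_tendsto_mean hX_meas hX_indep hX_law (φ := fun t => f t ^ 2)
    (hf_meas.pow_const 2) (B := M ^ 2) fun t => by
      rw [abs_pow]
      exact pow_le_pow_left₀ (abs_nonneg _) (habs t) 2
  have hgen := ae_genericSample hX_meas hX_indep hX_law
  have hwin : ∀ᶠ n in atTop, 2 ≤ m n ∧ 2 * m n < n := by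
    filter_upwards [hm.eventually_ge_atTop 2, eventually_gt_atTop 0,
      hmn.eventually_lt_const (show (0 : ℝ) < 1 / 2 by norm_num)] with n h1 h2 h3
    refine ⟨h1, ?_⟩
    rw [div_lt_iff₀ (by exact_mod_cast h2)] at h3
    have : 2 * (m n : ℝ) < n := by linarith
    exact_mod_cast this
  have hdev := tendstoInMeasure_spacingDeviation hX_meas hX_indep hX_law hm hmn
  have hsample : ∀ n : ℕ, Measurable fun ω => fun j : Fin n => X j ω := fun n =>
    measurable_pi_lambda _ fun j => hX_meas j
  have hV : ∀ n : ℕ, AEStronglyMeasurable (fun ω => VJQ (m n) fun j : Fin n => X j ω) P := fun n =>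
    ((measurable_VJQ (m n) n).comp (hsample n)).aestronglyMeasurable
  -- Convergence in probability is tested on subsequences: each has a further one along which the
  -- spacing deviation tends to 0 almost surely.
  refine (exists_seq_tendstoInMeasure_atTop_iff hV).2 ?_
  intro ns hns
  obtain ⟨ns', hns', hD⟩ := (hdev.comp hns.tendsto_atTop).exists_seq_tendsto_ae
  refine ⟨ns', hns', ?_⟩
  have hsub : Tendsto (fun i => ns (ns' i)) atTop atTop :=
    hns.tendsto_atTop.comp hns'.tendsto_atTop
  filter_upwards [hlln, hlln₁, hlln₂, hgen, hD] with ω h h₁ h₂ hx hDω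
  set l : Filter ℕ := map (fun i => ns (ns' i)) atTop with hldef
  have hl : l ≤ atTop := hsub
  have hDl : Tendsto (fun n => spacingDeviation (densityLaw f) (m n) fun j : Fin n => X j ω) l
      (𝓝 0) := tendsto_map'_iff.2 hDω
  have hE : Tendsto (fun n => windowError f (m n) fun j : Fin n => X j ω) l (𝓝 0) := by
    refine tendsto_windowError (x := fun j => X j ω) hf_meas hf_nonneg hfi hM0 hfM hx
      (hl hwin) (hmn.mono_left hl) hDl fun ε hε => ?_
    -- The denominator M + 1 makes both 1/(k + 1) and M/(k + 1) smaller than ε, covering the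
    -- Lebesgue error and the error under the law.
    obtain ⟨k, hk⟩ := exists_nat_one_div_lt (show 0 < ε / (M + 1) by positivity)
    rw [lt_div_iff₀ (by positivity)] at hk
    have hk0 : (0 : ℝ) < 1 / (k + 1) := by positivity
    have hint := integral_densityLaw_le hf_meas hf_nonneg hfM (hfi.sub (hgi k)).abs
      fun t => abs_nonneg _
    have hlt : ∫ t, |f t - g k t| ∂densityLaw f < ε :=
      calc _ ≤ M * ∫ t, |f t - g k t| := hint
        _ ≤ M * (1 / (k + 1)) := by
          gcongr
          exact hgε k
        _ < ε := by linarith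
    refine ⟨g k, hg k, hgc k, (hgε k).trans (by nlinarith), ?_⟩
    exact hl (((h k).eventually_lt_const hlt).mono fun n hn => hn.le)
  have hfin := tendsto_VJQ (x := fun j => X j ω) hf_meas hf_nonneg hfi hfM hx (hl hwin) hDl hE
    (h₁.mono_left hl) (h₂.mono_left hl)
  rw [varextropy_eq hf_meas hf_nonneg hM']
  exact tendsto_map'_iff.1 hfin
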